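/- Let $k$ be a field of characteristic $p\ge 0$, let $m,n\ge 0$, and let $V$ be a superspace over $k$ with a fixed ordered homogeneous basis $v_1,\dots,v_{m+n}$, of which $m$ vectors are even and $n$ are odd (in any order); write $\bar v_i\in\mathbb Z/2$ for the parity of $v_i$. Let $G=GL(V)$, and let $\mathrm{Dist}(G)=k\otimes_{\mathbb Z}U_{\mathbb Z}$ be its superalgebra of distributions. Here $U_{\mathbb C}$ is the universal enveloping superalgebra of the complex Lie superalgebra with basis the matrix units $e_{i,j}$ ($1\le i,j\le m+n$), of parity $\bar v_i+\bar v_j$, and bracket $[e_{i,j},e_{a,b}]=\delta_{j,a}e_{i,b}-(-1)^{(\bar v_i+\bar v_j)(\bar v_a+\bar v_b)}\delta_{i,b}e_{a,j}$, and $U_{\mathbb Z}\subset U_{\mathbb C}$ is the subring generated by the odd $e_{i,j}$, the divided powers $e_{i,j}^{r}/r!$ of the even $e_{i,j}$ with $i\ne j$, and the binomials $\binom{h_i}{r}$ with $h_i=e_{i,i}$. Let $X(T)=\bigoplus_{i=1}^{m+n}\mathbb Z\varepsilon_i$, with the form $(\varepsilon_i,\varepsilon_j)=(-1)^{\bar v_i}\delta_{i,j}$.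 For $\lambda=\sum_i\lambda_i\varepsilon_i\in X(T)$ let $M(\lambda)=\mathrm{Dist}(G)\otimes_{\mathrm{Dist}(B)}k_\lambda$ be the Verma supermodule, where $B$ is the upper triangular Borel subgroup and $k_\lambda$ is the one-dimensional even $\mathrm{Dist}(B)$-supermodule of weight $\lambda$, and let $L(\lambda)=M(\lambda)/\mathrm{Rad}\,M(\lambda)$ be its irreducible quotient. The $\lambda$-weight space of a supermodule $M$ is $M_\lambda=\{x\in M:\binom{h_i}{r}x=\binom{\lambda_i}{r}x \text{ for all } i,r\}$. Let $\mathcal O_p$ be the full subcategory of $\mathrm{Dist}(G)$-supermodules $M$ such that $M=\bigoplus_\lambda M_\lambda$, every $M_\lambda$ is finite dimensional, and there are finitely many weights $\lambda^{(1)},\dots,\lambda^{(s)}$ such that every weight of $M$ is $\le$ some $\lambda^{(t)}$, where $\mu\le\lambda$ means that $\lambda-\mu$ is a sum of roots $\varepsilon_i-\varepsilon_j$ with $i<j$. Morphisms of supermodules may be even or odd, so that $\mathrm{Ext}^1(M,N)=\mathrm{Ext}^1_{\mathrm{ev}}(M,N)\oplus\mathrm{Ext}^1_{\mathrm{ev}}(M,\Pi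 N)$, where $\mathrm{Ext}^1_{\mathrm{ev}}$ denotes classes of extensions by even morphisms and $\Pi$ is parity change. Let $P$ be the following lattice with elements $\gamma_a$ ($a\in\mathbb Z$). If $p=0$, then $P$ is free abelian on $\{\gamma_a\}_{a\in\mathbb Z}$. If $p>0$, then $P=\mathbb Z\delta\oplus\bigoplus_{r\in\mathbb Z/p\mathbb Z}\mathbb Z\Lambda_r$ and $\gamma_a=\Lambda_s-\Lambda_{s-1}-d\delta$, where $a=pd+s$ with $d\in\mathbb Z$, $1\le s\le p$. Put $\rho=\sum_j\bigl(\sum_{i>j}(-1)^{\bar v_i+\bar v_j}\bigr)\varepsilon_j+\sum_{\bar v_j=\bar 0}\varepsilon_j$, and define $\mathrm{wt}:X(T)\to P$ by $\mathrm{wt}(\lambda)=\sum_{i=1}^{m+n}(-1)^{\bar v_i}\gamma_{(\lambda+\rho,\varepsilon_i)}$. Theorem (linkage principle). Let $\lambda,\mu\in X(T)$. If $\mathrm{Ext}^1_{\mathrm{Dist}(G)}(L(\lambda),L(\mu))\neq 0$, then $\mathrm{wt}(\lambda)=\mathrm{wt}(\mu)$. This holds both when $\mathrm{Ext}^1$ is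 computed in $\mathcal O_p$ and when it is computed in the category of all $\mathrm{Dist}(G)$-supermodules. -/

import Mathlib

open scoped TensorProduct

universe u

noncomputable section

namespace SuperGL

/-! ### Signs and parities -/

/-- The sign `(-1)^s` of a parity `s`. -/
def sgn (s : ZMod 2) : ℤ := if s = 0 then 1 else -1

theorem sgn_zero : sgn 0 = 1 := rfl

theorem sgn_one : sgn 1 = -1 := rfl

theorem sgn_add (a b : ZMod 2) : sgn (a + b) = sgn a * sgn b := by
  revert a b; decide

theorem sgn_mul_self (a : ZMod 2) : sgn a * sgn a = 1 := by
  revert a; decide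

theorem sgn_cancel (a b c : ZMod 2) : sgn (a + b) * sgn (b + c) = sgn (a + c) := by
  revert a b c; decide

/-! ### Supermodules over a superalgebra -/

section Supermodules

variable {k : Type u} [Field k] {A : Type u} [Ring A] [Algebra k A]

/-- A (left) supermodule over the `k`-algebra `A` with even and odd parts `𝒜 0`, `𝒜 1`: a left
`A`-module `M = M₀ ⊕ M₁` with `A_r M_s ⊆ M_{r+s}`. -/
structure SuperMod (𝒜 : ZMod 2 → Submodule k A) where
  carrier : Type u
  [addCommGroup : AddCommGroup carrier]
  [modk : Module k carrier]
  [modA : Module A carrier]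
  [tower : IsScalarTower k A carrier]
  grade : ZMod 2 → Submodule k carrier
  isCompl : IsCompl (grade 0) (grade 1)
  smul_mem : ∀ {r s : ZMod 2} {a : A} {x : carrier},
    a ∈ 𝒜 r → x ∈ grade s → a • x ∈ grade (r + s)

attribute [instance] SuperMod.addCommGroup SuperMod.modk SuperMod.modA SuperMod.tower

namespace SuperMod

variable {𝒜 : ZMod 2 → Submodule k A}

/-- The parity change `Π M`: the same module with the two graded pieces interchanged. -/
def parityChange (M : SuperMod 𝒜) : SuperMod 𝒜 where
  carrier := M.carrier
  grade s := M.grade (s + 1)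
  isCompl := M.isCompl.symm
  smul_mem {r s a x} ha hx := by
    have h := M.smul_mem ha hx
    rwa [← add_assoc] at h

/-- The direct sum of two supermodules. -/
def prod (M N : SuperMod 𝒜) : SuperMod 𝒜 where
  carrier := M.carrier × N.carrier
  grade s := (M.grade s).prod (N.grade s)
  isCompl := by
    constructor
    · rw [disjoint_iff, Submodule.prod_inf_prod, M.isCompl.inf_eq_bot, N.isCompl.inf_eq_bot,
        Submodule.prod_bot]
    · rw [codisjoint_iff, Submodule.prod_sup_prod, M.isCompl.sup_eq_top, N.isCompl.sup_eq_top,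
        Submodule.prod_top]
  smul_mem ha hx := ⟨M.smul_mem ha hx.1, N.smul_mem ha hx.2⟩

/-- An `A`-submodule is a subsupermodule if it is the sum of its intersections with the graded
pieces. -/
def IsHomogeneous (M : SuperMod 𝒜) (N : Submodule A M.carrier) : Prop :=
  ∀ x ∈ N, ∃ y ∈ N, ∃ z ∈ N, y ∈ M.grade 0 ∧ z ∈ M.grade 1 ∧ x = y + z

theorem IsHomogeneous.mem {M : SuperMod 𝒜} {N : Submodule A M.carrier} (hN : M.IsHomogeneous N)
    {y z : M.carrier} (hy : y ∈ M.grade 0) (hz : z ∈ M.grade 1) (h : y + z ∈ N) :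
    y ∈ N ∧ z ∈ N := by
  obtain ⟨y', hy'N, z', hz'N, hy', hz', e⟩ := hN _ h
  have e1 : y - y' = z' - z := by
    rw [sub_eq_sub_iff_add_eq_add, e, add_comm]
  have h0 : y - y' = 0 := by
    have : y - y' ∈ M.grade 0 ⊓ M.grade 1 :=
      ⟨sub_mem hy hy', by rw [e1]; exact sub_mem hz' hz⟩
    rw [M.isCompl.inf_eq_bot] at this
    simpa using this
  have h1 : z' - z = 0 := by rw [← e1, h0]
  rw [sub_eq_zero] at h0 h1
  exact ⟨h0 ▸ hy'N, h1 ▸ hz'N⟩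

theorem exists_decomp (M : SuperMod 𝒜) (x : M.carrier) :
    ∃ y ∈ M.grade 0, ∃ z ∈ M.grade 1, y + z = x := by
  have : x ∈ M.grade 0 ⊔ M.grade 1 := by rw [M.isCompl.sup_eq_top]; trivial
  exact Submodule.mem_sup.1 this

/-- The quotient of a supermodule by a subsupermodule. -/
def quot (M : SuperMod 𝒜) (N : Submodule A M.carrier) (hN : M.IsHomogeneous N) :
    SuperMod 𝒜 where
  carrier := M.carrier ⧸ N
  grade s := (M.grade s).map (N.mkQ.restrictScalars k)
  isCompl := by
    constructor
    · rw [Submodule.disjoint_def]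
      rintro _ ⟨y, hy, rfl⟩ ⟨z, hz, e⟩
      have e' : y - z ∈ N := (Submodule.Quotient.eq N).1 e.symm
      have := (hN.mem hy (neg_mem hz) (by rwa [← sub_eq_add_neg])).1
      exact (Submodule.Quotient.mk_eq_zero N).2 this
    · rw [codisjoint_iff, ← Submodule.map_sup, M.isCompl.sup_eq_top, Submodule.map_top,
        LinearMap.range_eq_top]
      exact N.mkQ_surjective
  smul_mem := by
    rintro r s a _ ha ⟨x, hx, rfl⟩
    exact ⟨a • x, M.smul_mem ha hx, rfl⟩

/-- The maximal (proper) subsupermodules. -/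
def maximalSubs (M : SuperMod 𝒜) : Set (Submodule A M.carrier) :=
  {N | M.IsHomogeneous N ∧ N ≠ ⊤ ∧ ∀ N', M.IsHomogeneous N' → N' ≠ ⊤ → N ≤ N' → N' = N}

/-- The radical: the intersection of all maximal subsupermodules. -/
def rad (M : SuperMod 𝒜) : Submodule A M.carrier := sInf M.maximalSubs

theorem rad_isHomogeneous (M : SuperMod 𝒜) : M.IsHomogeneous M.rad := by
  intro x hx
  obtain ⟨y, hy, z, hz, rfl⟩ := M.exists_decomp x
  rw [rad, Submodule.mem_sInf] at hx
  refine ⟨y, ?_, z, ?_, hy, hz, rfl⟩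
  · rw [rad, Submodule.mem_sInf]
    exact fun N hN => (hN.1.mem hy hz (hx N hN)).1
  · rw [rad, Submodule.mem_sInf]
    exact fun N hN => (hN.1.mem hy hz (hx N hN)).2

/-- The head `M / Rad M`. -/
def head (M : SuperMod 𝒜) : SuperMod 𝒜 := M.quot M.rad M.rad_isHomogeneous

/-- A short exact sequence `0 → N → E → M → 0` of supermodules and even homomorphisms. -/
structure Extension (M N : SuperMod 𝒜) where
  E : SuperMod 𝒜
  i : N.carrier →ₗ[A] E.carrier
  q : E.carrier →ₗ[A] M.carrier
  i_even : ∀ s, ∀ x ∈ N.grade s, i x ∈ E.grade s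
  q_even : ∀ s, ∀ x ∈ E.grade s, q x ∈ M.grade s
  i_injective : Function.Injective i
  q_surjective : Function.Surjective q
  exact : Function.Exact i q

/-- Equivalence of extensions: an even isomorphism of the middle terms that is the identity on
the outer terms. -/
def Extension.Equivalent {M N : SuperMod 𝒜} (X Y : Extension M N) : Prop :=
  ∃ e : X.E.carrier ≃ₗ[A] Y.E.carrier,
    (∀ s x, x ∈ X.E.grade s ↔ e x ∈ Y.E.grade s) ∧
    (∀ x, e (X.i x) = Y.i x) ∧ (∀ x, Y.q (e x) = X.q x)

instance extensionSetoid (M N : SuperMod 𝒜) : Setoid (Extension M N) where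
  r := Extension.Equivalent
  iseqv :=
    { refl := fun _ => ⟨LinearEquiv.refl A _, fun _ _ => Iff.rfl, fun _ => rfl, fun _ => rfl⟩
      symm := by
        rintro X Y ⟨e, h1, h2, h3⟩
        refine ⟨e.symm, fun s x => ?_, fun x => ?_, fun x => ?_⟩
        · rw [h1, e.apply_symm_apply]
        · rw [← h2, e.symm_apply_apply]
        · rw [← h3, e.apply_symm_apply]
      trans := by
        rintro X Y Z ⟨e, h1, h2, h3⟩ ⟨f, g1, g2, g3⟩
        refine ⟨e.trans f, fun s x => ?_, fun x => ?_, fun x => ?_⟩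
        · rw [h1, g1]; rfl
        · rw [LinearEquiv.trans_apply, h2, g2]
        · rw [LinearEquiv.trans_apply, g3, h3] }

/-- The split extension `0 → N → N ⊕ M → M → 0`. -/
def Extension.split (M N : SuperMod 𝒜) : Extension M N where
  E := N.prod M
  i := LinearMap.inl A N.carrier M.carrier
  q := LinearMap.snd A N.carrier M.carrier
  i_even _ _ hx := ⟨hx, Submodule.zero_mem _⟩
  q_even _ _ hx := hx.2
  i_injective := LinearMap.inl_injective
  q_surjective := LinearMap.snd_surjective
  exact := Function.Exact.inl_snd

/-- `Ext¹(M, N)` in the underlying even category (Yoneda's description): equivalence classes of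
extensions of `M` by `N`. -/
def EvenExt1 (M N : SuperMod 𝒜) : Type (u + 1) := Quotient (extensionSetoid M N)

/-- The zero element of `Ext¹` is the class of the split extension. -/
instance (M N : SuperMod 𝒜) : Zero (EvenExt1 M N) :=
  ⟨Quotient.mk (extensionSetoid M N) (Extension.split M N)⟩

/-- `Ext¹(M, N)` in the category with all morphisms (even and odd): the direct sum of the even
part `Ext¹_even(M, N)` and the odd part `Ext¹_even(M, Π N)`. -/
abbrev Ext1 (M N : SuperMod 𝒜) : Type (u + 1) := EvenExt1 M N × EvenExt1 M N.parityChange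

/-- For a full subcategory given by a property `C` of supermodules, the classes in
`Ext¹_even(M, N)` that are represented by an extension with middle term in `C`. -/
def evenExt1In (C : SuperMod 𝒜 → Prop) (M N : SuperMod 𝒜) : Set (EvenExt1 M N) :=
  {ξ | ∃ X : Extension M N, C X.E ∧ Quotient.mk (extensionSetoid M N) X = ξ}

/-- `Ext¹(M, N)` computed in the full subcategory given by `C`, as a subset of `Ext¹(M, N)`
computed in the category of all supermodules. -/
def ext1In (C : SuperMod 𝒜 → Prop) (M N : SuperMod 𝒜) : Set (Ext1 M N) :=
  evenExt1In C M N ×ˢ evenExt1In C M N.parityChange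

end SuperMod

end Supermodules

/-! ### The enveloping superalgebra and its Kostant form

`N` is the dimension of the superspace `V` and `v i` is the parity of the `i`-th basis vector. -/

variable {N : ℕ} (v : Fin N → ZMod 2)

/-- The relations `xy - (-1)^{|x||y|} yx = [x, y]` for matrix units `x = e_{i,j}`,
`y = e_{a,b}`, with the superbracket
`[e_{i,j}, e_{a,b}] = δ_{j,a} e_{i,b} - (-1)^{|x||y|} δ_{i,b} e_{a,j}`. -/
inductive EnvRel : FreeAlgebra ℂ (Fin N × Fin N) → FreeAlgebra ℂ (Fin N × Fin N) → Prop
  | bracket (i j a b : Fin N) :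
      EnvRel
        (FreeAlgebra.ι ℂ (i, j) * FreeAlgebra.ι ℂ (a, b)
          - sgn ((v i + v j) * (v a + v b)) • (FreeAlgebra.ι ℂ (a, b) * FreeAlgebra.ι ℂ (i, j)))
        ((if j = a then FreeAlgebra.ι ℂ (i, b) else 0)
          - sgn ((v i + v j) * (v a + v b)) • (if i = b then FreeAlgebra.ι ℂ (a, j) else 0))

/-- The universal enveloping superalgebra of the complex Lie superalgebra of all matrices. -/
def Env : Type := RingQuot (EnvRel v)

instance : Ring (Env v) := inferInstanceAs (Ring (RingQuot (EnvRel v)))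

instance : Algebra ℂ (Env v) := inferInstanceAs (Algebra ℂ (RingQuot (EnvRel v)))

/-- The matrix unit `e_{i,j}` in the enveloping superalgebra. -/
def e (i j : Fin N) : Env v := RingQuot.mkAlgHom ℂ (EnvRel v) (FreeAlgebra.ι ℂ (i, j))

theorem e_bracket (i j a b : Fin N) :
    e v i j * e v a b - sgn ((v i + v j) * (v a + v b)) • (e v a b * e v i j) =
      (if j = a then e v i b else 0)
        - sgn ((v i + v j) * (v a + v b)) • (if i = b then e v a j else 0) := by
  have h := RingQuot.mkAlgHom_rel ℂ (EnvRel.bracket (v := v) i j a b)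
  simp only [map_sub, map_mul, map_zsmul, apply_ite (RingQuot.mkAlgHom ℂ (EnvRel v)),
    map_zero] at h
  exact h

/-- The parity automorphism, `x ↦ (-1)^{|x|} x` on homogeneous elements. -/
def parityHom : Env v →ₐ[ℂ] Env v :=
  RingQuot.liftAlgHom ℂ
    ⟨FreeAlgebra.lift ℂ fun q : Fin N × Fin N => sgn (v q.1 + v q.2) • e v q.1 q.2, by
      rintro _ _ ⟨i, j, a, b⟩
      have h := congrArg (fun t => (sgn (v i + v j) * sgn (v a + v b)) • t) (e_bracket v i j a b)
      simp only [map_sub, map_mul, map_zsmul, apply_ite (FreeAlgebra.lift ℂ _), map_zero,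
        FreeAlgebra.lift_ι_apply]
      simp only [smul_sub] at h
      convert h using 2
      · simp only [smul_mul_assoc, mul_smul_comm, smul_smul]
        congr 1; ring
      · simp only [smul_mul_assoc, mul_smul_comm, smul_smul]
        congr 1; ring
      · split_ifs with hja
        · subst hja; rw [sgn_cancel]
        · simp
      · rw [smul_comm]
        split_ifs with hib
        · subst hib
          rw [mul_comm (sgn (v i + v j)), sgn_cancel]
        · simp⟩

theorem parityHom_e (i j : Fin N) : parityHom v (e v i j) = sgn (v i + v j) • e v i j := by
  unfold parityHom e
  erw [RingQuot.liftAlgHom_mkAlgHom_apply]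
  rw [FreeAlgebra.lift_ι_apply]

/-- The divided power `e_{i,j}^{(r)} = e_{i,j}^r / r!`. -/
def divPow (i j : Fin N) (r : ℕ) : Env v := ((r.factorial : ℂ)⁻¹) • (e v i j) ^ r

/-- The binomial `h_i (h_i - 1) ⋯ (h_i - r + 1) / r!`, where `h_i = e_{i,i}`. -/
def hBinom (i : Fin N) (r : ℕ) : Env v :=
  ((r.factorial : ℂ)⁻¹) • ((List.range r).map fun t : ℕ => e v i i - (t : Env v)).prod

/-- The generators of the Kostant form (for `r = 0` the last two kinds give `1`). -/
def kostantGens : Set (Env v) :=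
  {x | ∃ i j, v i + v j = 1 ∧ x = e v i j} ∪
  {x | ∃ i j r, i ≠ j ∧ v i + v j = 0 ∧ x = divPow v i j r} ∪
  {x | ∃ i r, x = hBinom v i r}

/-- The Kostant `ℤ`-form of the enveloping superalgebra. -/
def kostant : Subring (Env v) := Subring.closure (kostantGens v)

/-- An odd matrix unit as an element of the Kostant form. -/
def oddUnit (i j : Fin N) (h : v i + v j = 1) : kostant v :=
  ⟨e v i j, Subring.subset_closure (Or.inl (Or.inl ⟨i, j, h, rfl⟩))⟩

/-- An even divided power as an element of the Kostant form. -/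
def evenDivPow (i j : Fin N) (hij : i ≠ j) (h : v i + v j = 0) (r : ℕ) : kostant v :=
  ⟨divPow v i j r, Subring.subset_closure (Or.inl (Or.inr ⟨i, j, r, hij, h, rfl⟩))⟩

/-- The binomial in `h_i` as an element of the Kostant form. -/
def torusBinom (i : Fin N) (r : ℕ) : kostant v :=
  ⟨hBinom v i r, Subring.subset_closure (Or.inr ⟨i, r, rfl⟩)⟩

/-- The homogeneous part of parity `s` of the Kostant form. -/
def kostantGrade (s : ZMod 2) : Submodule ℤ (kostant v) where
  carrier := {x | parityHom v (x : Env v) = sgn s • (x : Env v)}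
  zero_mem' := by simp
  add_mem' {x y} hx hy := by
    simp only [Set.mem_ofPred_eq] at *
    simp [hx, hy, smul_add]
  smul_mem' c x hx := by
    simp only [Set.mem_ofPred_eq] at *
    simp only [AddSubgroupClass.coe_zsmul, map_zsmul, hx]
    rw [smul_comm]

theorem mem_kostantGrade {s : ZMod 2} {x : kostant v} :
    x ∈ kostantGrade v s ↔ parityHom v (x : Env v) = sgn s • (x : Env v) := Iff.rfl

theorem kostantGrade_mul {r s : ZMod 2} {x y : kostant v} (hx : x ∈ kostantGrade v r)
    (hy : y ∈ kostantGrade v s) : x * y ∈ kostantGrade v (r + s) := by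
  rw [mem_kostantGrade] at *
  rw [Subring.coe_mul, map_mul, hx, hy, sgn_add, smul_mul_assoc, mul_smul_comm, smul_smul]

theorem oddUnit_mem (i j : Fin N) (h : v i + v j = 1) :
    oddUnit v i j h ∈ kostantGrade v 1 := by
  rw [mem_kostantGrade, oddUnit, parityHom_e, h]

theorem evenDivPow_mem (i j : Fin N) (hij : i ≠ j) (h : v i + v j = 0) (r : ℕ) :
    evenDivPow v i j hij h r ∈ kostantGrade v 0 := by
  rw [mem_kostantGrade]
  simp [evenDivPow, divPow, parityHom_e, h, sgn_zero]

theorem torusBinom_mem (i : Fin N) (r : ℕ) : torusBinom v i r ∈ kostantGrade v 0 := by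
  rw [mem_kostantGrade]
  have h0 : v i + v i = 0 := CharTwo.add_self_eq_zero _
  simp [torusBinom, hBinom, parityHom_e, h0, sgn_zero, map_list_prod, Function.comp_def]

theorem one_mem_kostantGrade : (1 : kostant v) ∈ kostantGrade v 0 := by
  simp [mem_kostantGrade, sgn_zero]

theorem kostantGrade_sup_mul {x y : kostant v} (hx : x ∈ kostantGrade v 0 ⊔ kostantGrade v 1)
    (hy : y ∈ kostantGrade v 0 ⊔ kostantGrade v 1) :
    x * y ∈ kostantGrade v 0 ⊔ kostantGrade v 1 := by
  obtain ⟨a, ha, b, hb, rfl⟩ := Submodule.mem_sup.1 hx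
  obtain ⟨c, hc, d, hd, rfl⟩ := Submodule.mem_sup.1 hy
  rw [add_mul a b (c + d), mul_add a c d, mul_add b c d]
  refine Submodule.add_mem _ (Submodule.add_mem _ ?_ ?_) (Submodule.add_mem _ ?_ ?_)
  · have h := kostantGrade_mul v ha hc
    rw [show (0 : ZMod 2) + 0 = 0 from rfl] at h
    exact Submodule.mem_sup_left h
  · have h := kostantGrade_mul v ha hd
    rw [show (0 : ZMod 2) + 1 = 1 from rfl] at h
    exact Submodule.mem_sup_right h
  · have h := kostantGrade_mul v hb hc
    rw [show (1 : ZMod 2) + 0 = 1 from rfl] at h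
    exact Submodule.mem_sup_right h
  · have h := kostantGrade_mul v hb hd
    rw [show (1 : ZMod 2) + 1 = 0 from rfl] at h
    exact Submodule.mem_sup_left h

theorem kostantGrade_sup : kostantGrade v 0 ⊔ kostantGrade v 1 = ⊤ := by
  rw [eq_top_iff]
  rintro ⟨x, hx⟩ -
  induction hx using Subring.closure_induction with
  | mem x hx =>
    rcases hx with (⟨i, j, h, rfl⟩ | ⟨i, j, r, hij, h, rfl⟩) | ⟨i, r, rfl⟩
    · exact Submodule.mem_sup_right (oddUnit_mem v i j h)
    · exact Submodule.mem_sup_left (evenDivPow_mem v i j hij h r)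
    · exact Submodule.mem_sup_left (torusBinom_mem v i r)
  | zero => exact Submodule.zero_mem _
  | one => exact Submodule.mem_sup_left (one_mem_kostantGrade v)
  | add x y hx hy h1 h2 => exact Submodule.add_mem _ h1 h2
  | neg x hx h => exact Submodule.neg_mem _ h
  | mul x y hx hy h1 h2 => exact kostantGrade_sup_mul v h1 h2

theorem kostantGrade_isCompl : IsCompl (kostantGrade v 0) (kostantGrade v 1) := by
  constructor
  · rw [Submodule.disjoint_def]
    intro x h0 h1
    rw [mem_kostantGrade, sgn_zero, one_smul] at h0
    rw [mem_kostantGrade, sgn_one, h0, neg_smul, one_smul] at h1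
    have h2 : (2 : ℂ) • (x : Env v) = 0 := by
      rw [two_smul]
      nth_rewrite 1 [h1]
      simp
    have h3 : (x : Env v) = 0 := by
      have := congrArg (fun t => (2⁻¹ : ℂ) • t) h2
      simpa [smul_smul] using this
    exact Subtype.ext h3
  · exact codisjoint_iff.2 (kostantGrade_sup v)

/-! ### The superalgebra of distributions -/

variable (k : Type u) [Field k]

/-- The superalgebra of distributions `Dist(G) = k ⊗_ℤ U_ℤ` of `G = GL(V)`. -/
abbrev Dist : Type u := k ⊗[ℤ] (kostant v)

/-- The homogeneous part of parity `s` of `Dist(G)`. -/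
def distGrade (s : ZMod 2) : Submodule k (Dist v k) := (kostantGrade v s).baseChange k

/-- The image of an element of the Kostant form in `Dist(G)`. -/
def toDist (x : kostant v) : Dist v k := (1 : k) ⊗ₜ[ℤ] x

theorem toDist_mem {s : ZMod 2} {x : kostant v} (hx : x ∈ kostantGrade v s) :
    toDist v k x ∈ distGrade v k s :=
  Submodule.tmul_mem_baseChange_of_mem 1 hx

theorem distGrade_isCompl : IsCompl (distGrade v k 0) (distGrade v k 1) := by
  have hc := kostantGrade_isCompl v
  constructor
  · let f : kostant v →ₗ[ℤ] kostant v :=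
      (kostantGrade v 0).subtype ∘ₗ Submodule.projectionOnto _ _ hc
    have h0 : ∀ x ∈ distGrade v k 0, f.baseChange k x = x := by
      intro x hx
      rw [distGrade, Submodule.baseChange_eq_span] at hx
      induction hx using Submodule.span_induction with
      | mem x hx =>
        obtain ⟨y, hy, rfl⟩ := hx
        have : f y = y := by
          have := Submodule.projectionOnto_apply_left hc ⟨y, hy⟩
          exact congrArg Subtype.val this
        simp [this]
      | zero => simp
      | add x y _ _ h1 h2 => rw [map_add, h1, h2]
      | smul c x _ h => rw [map_smul, h]
    have h1 : ∀ x ∈ distGrade v k 1, f.baseChange k x = 0 := by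
      intro x hx
      rw [distGrade, Submodule.baseChange_eq_span] at hx
      induction hx using Submodule.span_induction with
      | mem x hx =>
        obtain ⟨y, hy, rfl⟩ := hx
        have : f y = 0 := by
          have := Submodule.projectionOnto_apply_right hc ⟨y, hy⟩
          exact congrArg Subtype.val this
        simp [this]
      | zero => simp
      | add x y _ _ h1 h2 => rw [map_add, h1, h2, add_zero]
      | smul c x _ h => rw [map_smul, h, smul_zero]
    rw [Submodule.disjoint_def]
    intro x hx0 hx1
    rw [← h0 x hx0, h1 x hx1]
  · rw [codisjoint_iff, eq_top_iff]
    rintro x -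
    induction x using TensorProduct.induction_on with
    | zero => exact Submodule.zero_mem _
    | add x y h1 h2 => exact Submodule.add_mem _ h1 h2
    | tmul c x =>
      have hx : x ∈ kostantGrade v 0 ⊔ kostantGrade v 1 := by
        rw [kostantGrade_sup]; trivial
      obtain ⟨y, hy, z, hz, rfl⟩ := Submodule.mem_sup.1 hx
      rw [TensorProduct.tmul_add]
      exact Submodule.add_mem _
        (Submodule.mem_sup_left (Submodule.tmul_mem_baseChange_of_mem c hy))
        (Submodule.mem_sup_right (Submodule.tmul_mem_baseChange_of_mem c hz))

theorem distGrade_mul {r s : ZMod 2} {x y : Dist v k} (hx : x ∈ distGrade v k r)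
    (hy : y ∈ distGrade v k s) : x * y ∈ distGrade v k (r + s) := by
  rw [distGrade, Submodule.baseChange_eq_span] at hx hy
  induction hx using Submodule.span_induction with
  | mem x hx =>
    obtain ⟨a, ha, rfl⟩ := hx
    induction hy using Submodule.span_induction with
    | mem y hy =>
      obtain ⟨b, hb, rfl⟩ := hy
      have : (TensorProduct.mk ℤ k (kostant v) 1 a) * (TensorProduct.mk ℤ k (kostant v) 1 b)
          = toDist v k (a * b) := by
        simp [toDist]
      rw [this]
      exact toDist_mem v k (kostantGrade_mul v ha hb)
    | zero => rw [mul_zero]; exact Submodule.zero_mem _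
    | add x y _ _ h1 h2 => rw [mul_add]; exact Submodule.add_mem _ h1 h2
    | smul c x _ h => rw [mul_smul_comm]; exact Submodule.smul_mem _ _ h
  | zero => rw [zero_mul]; exact Submodule.zero_mem _
  | add x y _ _ h1 h2 => rw [add_mul]; exact Submodule.add_mem _ h1 h2
  | smul c x _ h => rw [smul_mul_assoc]; exact Submodule.smul_mem _ _ h

/-- `Dist(G)`-supermodules. -/
abbrev DistMod : Type (u + 1) := SuperMod (distGrade v k)

/-- `Dist(G)` as a left supermodule over itself. -/
def regular : DistMod v k where
  carrier := Dist v k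
  grade := distGrade v k
  isCompl := distGrade_isCompl v k
  smul_mem := distGrade_mul v k

/-! ### Weights, highest weight modules and the category `𝒪_p` -/

/-- The character group `X(T)`; `lam i` is the coefficient of `ε_i`. -/
abbrev Weight (N : ℕ) : Type := Fin N → ℤ

variable {v k}

/-- The `lam`-weight space of a `Dist(G)`-supermodule. -/
def weightSpace (M : DistMod v k) (lam : Weight N) : Submodule k M.carrier where
  carrier := {x | ∀ i r,
    toDist v k (torusBinom v i r) • x = ((Ring.choose (lam i) r : ℤ) : k) • x}
  zero_mem' := by simp
  add_mem' {x y} hx hy := by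
    intro i r
    rw [smul_add, smul_add, hx, hy]
  smul_mem' c x hx := by
    intro i r
    rw [smul_algebra_smul_comm, hx, smul_comm]

/-- The positive roots `ε_i - ε_j`, `i < j`. -/
def positiveRoots (N : ℕ) : Set (Weight N) :=
  {a | ∃ i j, i < j ∧ a = Pi.single i 1 - Pi.single j 1}

/-- The dominance order: `mu - lam` is a sum of positive roots. -/
def DominanceLE (lam mu : Weight N) : Prop := mu - lam ∈ AddSubmonoid.closure (positiveRoots N)

/-- The objects of the category `𝒪_p`: direct sums of their finite dimensional weight spaces,
with all weights below one of finitely many given weights. -/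
structure InO (M : DistMod v k) : Prop where
  isInternal : DirectSum.IsInternal (weightSpace M)
  finite : ∀ lam, FiniteDimensional k (weightSpace M lam)
  bounded : ∃ S : Finset (Weight N),
    ∀ mu, weightSpace M mu ≠ ⊥ → ∃ lam ∈ S, DominanceLE mu lam

variable (v k)

/-- Generators of the annihilator of the one dimensional `Dist(B)`-module `k_lam`: the elements
`e_{i,j}^{(r)}` for `i < j`, `r ≥ 1` (only `r = 1` if `e_{i,j}` is odd) and
`binom(h_i, r) - binom(lam_i, r)`. -/
def borelRelations (lam : Weight N) : Set (Dist v k) :=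
  {x | ∃ i j, ∃ h : v i + v j = 1, i < j ∧ x = toDist v k (oddUnit v i j h)} ∪
  {x | ∃ i j, ∃ hij : i < j, ∃ h : v i + v j = 0, ∃ r, 1 ≤ r ∧
    x = toDist v k (evenDivPow v i j hij.ne h r)} ∪
  {x | ∃ i r, x = toDist v k (torusBinom v i r)
    - algebraMap k (Dist v k) ((Ring.choose (lam i) r : ℤ) : k)}

theorem one_mem_distGrade : (1 : Dist v k) ∈ distGrade v k 0 :=
  toDist_mem v k (one_mem_kostantGrade v)

theorem borelRelations_homogeneous (lam : Weight N) {x : Dist v k}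
    (hx : x ∈ borelRelations v k lam) : ∃ s, x ∈ distGrade v k s := by
  rcases hx with (⟨i, j, h, _, rfl⟩ | ⟨i, j, hij, h, r, _, rfl⟩) | ⟨i, r, rfl⟩
  · exact ⟨1, toDist_mem v k (oddUnit_mem v i j h)⟩
  · exact ⟨0, toDist_mem v k (evenDivPow_mem v i j hij.ne h r)⟩
  · refine ⟨0, Submodule.sub_mem _ (toDist_mem v k (torusBinom_mem v i r)) ?_⟩
    rw [Algebra.algebraMap_eq_smul_one]
    exact Submodule.smul_mem _ _ (one_mem_distGrade v k)

/-- The left ideal of `Dist(G)` generated by the annihilator of `k_lam` in `Dist(B)`. -/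
def vermaIdeal (lam : Weight N) : Submodule (Dist v k) (Dist v k) :=
  Submodule.span (Dist v k) (borelRelations v k lam)

theorem vermaIdeal_mul (lam : Weight N) (a : Dist v k) {x : Dist v k}
    (hx : x ∈ vermaIdeal v k lam) {s : ZMod 2} (hs : x ∈ distGrade v k s) :
    ∃ y ∈ vermaIdeal v k lam, ∃ z ∈ vermaIdeal v k lam,
      y ∈ distGrade v k 0 ∧ z ∈ distGrade v k 1 ∧ a * x = y + z := by
  obtain ⟨b, hb, c, hc, hbc⟩ : ∃ b ∈ distGrade v k 0, ∃ c ∈ distGrade v k 1, b + c = a :=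
    (regular v k).exists_decomp a
  have hbx : b * x ∈ vermaIdeal v k lam := Submodule.smul_mem _ b hx
  have hcx : c * x ∈ vermaIdeal v k lam := Submodule.smul_mem _ c hx
  have h1 := distGrade_mul v k hb hs
  have h2 := distGrade_mul v k hc hs
  have h3 : a * x = b * x + c * x := by rw [← hbc]; exact add_mul b c x
  fin_cases s
  · exact ⟨_, hbx, _, hcx, h1, h2, h3⟩
  · exact ⟨_, hcx, _, hbx, h2, h1, h3.trans (add_comm _ _)⟩

theorem vermaIdeal_isHomogeneous (lam : Weight N) :
    (regular v k).IsHomogeneous (vermaIdeal v k lam) := by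
  suffices h : ∀ x ∈ vermaIdeal v k lam, ∃ y ∈ vermaIdeal v k lam, ∃ z ∈ vermaIdeal v k lam,
      y ∈ distGrade v k 0 ∧ z ∈ distGrade v k 1 ∧ x = y + z from h
  intro x hx
  induction hx using Submodule.span_induction with
  | mem x hx =>
    obtain ⟨s, hs⟩ := borelRelations_homogeneous v k lam hx
    have := vermaIdeal_mul v k lam 1 (Submodule.subset_span hx) hs
    rwa [one_mul x] at this
  | zero => exact ⟨0, Submodule.zero_mem _, 0, Submodule.zero_mem _, Submodule.zero_mem _,
      Submodule.zero_mem _, (add_zero _).symm⟩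
  | add x y _ _ h1 h2 =>
    obtain ⟨a, ha, b, hb, ha', hb', rfl⟩ := h1
    obtain ⟨c, hc, d, hd, hc', hd', rfl⟩ := h2
    exact ⟨a + c, Submodule.add_mem _ ha hc, b + d, Submodule.add_mem _ hb hd,
      Submodule.add_mem _ ha' hc', Submodule.add_mem _ hb' hd', add_add_add_comm _ _ _ _⟩
  | smul a x _ h =>
    obtain ⟨y, hy, z, hz, hy', hz', rfl⟩ := h
    obtain ⟨c, hc, d, hd, hc', hd', e1⟩ := vermaIdeal_mul v k lam a hy hy'
    obtain ⟨c', hc1, d', hd1, hc2, hd2, e2⟩ := vermaIdeal_mul v k lam a hz hz'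
    refine ⟨c + c', Submodule.add_mem _ hc hc1, d + d', Submodule.add_mem _ hd hd1,
      Submodule.add_mem _ hc' hc2, Submodule.add_mem _ hd' hd2, ?_⟩
    have e3 : a • (y + z) = a * y + a * z := mul_add a y z
    rw [e3, e1, e2]
    exact add_add_add_comm _ _ _ _

/-- The Verma module `M(lam) = Dist(G) ⊗_{Dist(B)} k_lam`, realized as the quotient of `Dist(G)`
by the left ideal generated by the annihilator of `k_lam`; its canonical generator is the image
of `1` and is even. -/
def verma (lam : Weight N) : DistMod v k :=
  (regular v k).quot (vermaIdeal v k lam) (vermaIdeal_isHomogeneous v k lam)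

/-- The irreducible quotient `L(lam) = M(lam) / Rad M(lam)`. -/
def simple (lam : Weight N) : DistMod v k := (verma v k lam).head

/-! ### The weight function -/

/-- The bilinear form `(ε_i, ε_j) = (-1)^{v i} δ_{i,j}` on `X(T)`. -/
def form (lam mu : Weight N) : ℤ := ∑ i, sgn (v i) * lam i * mu i

/-- The weight `ρ`, with `ε_j`-coefficient `∑_{i > j} (-1)^{v i + v j}`, plus one if `v j` is
even. -/
def rho : Weight N := fun j =>
  (∑ i ∈ Finset.Ioi j, sgn (v i + v j)) + if v j = 0 then 1 else 0

/-- The weight lattice `P`. For `p = 0` it is free on `γ_r` (`r ∈ ℤ`); for `p > 0` it is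
`ℤ δ ⊕ ⨁_{r ∈ ℤ/p} ℤ Λ_r`. -/
def Lattice : ℕ → Type
  | 0 => ℤ →₀ ℤ
  | (q + 1) => ℤ × (ZMod (q + 1) →₀ ℤ)

instance : (p : ℕ) → AddCommGroup (Lattice p)
  | 0 => inferInstanceAs (AddCommGroup (ℤ →₀ ℤ))
  | (q + 1) => inferInstanceAs (AddCommGroup (ℤ × (ZMod (q + 1) →₀ ℤ)))

/-- The elements `γ_a` of `P` (`a ∈ ℤ`). For `p > 0`, write `a = p d + s` with `1 ≤ s ≤ p`;
then `γ_a = Λ_s - Λ_{s-1} - d δ`. -/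
def gam : (p : ℕ) → ℤ → Lattice p
  | 0, a => Finsupp.single a 1
  | (q + 1), a =>
      (-((a - 1) / ((q + 1 : ℕ) : ℤ)),
        Finsupp.single (a : ZMod (q + 1)) 1 - Finsupp.single ((a : ZMod (q + 1)) - 1) 1)

/-- The weight function `wt(lam) = ∑ (-1)^{v i} γ_{(lam + ρ, ε_i)}` of the crystal `X(T)`. -/
def wt (p : ℕ) (lam : Weight N) : Lattice p :=
  ∑ i, sgn (v i) • gam p (form v (lam + rho v) (Pi.single i 1))

end SuperGL

end

/-!
The linkage principle holds because enough elements of the center of `Dist(G)` are available, with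
eigenvalues on `L(lam)` that determine `wt lam`.

An even central element `z` which acts by `c` on `M` and by `d ≠ c` on `N` splits every extension
`0 → N → E → M → 0`: the action of `(c - d)⁻¹ (z - d)` on `E` kills `N` and induces a section of
`E → M` (`SuperMod.evenExt1_eq_zero`). The action on `Π N` is the same as on `N`, so the odd part of
`Ext¹` vanishes too, and the statement for `𝒪_p` follows from that for all supermodules. On
`L(lam)`, a quotient of `Dist(G)` as a module, a central element acts by the scalar by which it acts
on the highest weight vector (`simple_smul`); neither the irreducibility of `L(lam)` nor a
Poincaré-Birkhoff-Witt basis is needed.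

Two families of central elements, all of them in the Kostant form, are used.

* The Gelfand invariants, the traces of the powers of the matrix `(e_{i,j})` with suitable signs
  (`commute_gelfand`). On a highest weight vector the powers of the matrix are triangular, and the
  generating function of the eigenvalues `z_r` is a product (`eigSeries_prod`): with
  `a_i = (lam + ρ, ε_i)`,
  `1 - ∑ z_r X ^ (r + 1) = ∏ ((1 - a_i X) / (1 - (a_i - 1) X)) ^ ((-1)^{v i})`.
  No division by `r` occurs, so this keeps its information modulo `p`: unique factorization
  recovers `∑ (-1)^{v i} ([a_i] - [a_i - 1])`, where `[a]` is the class of `a` in the free abelian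
  group on `ℤ/p`. A function on `ℤ/p` (or a finitely supported one on `ℤ`) with a given difference
  derivative and a given total is unique, which gives `∑ (-1)^{v i} [a_i]`
  (`sum_single_zmod_eq`); this is `wt lam` if `p = 0`, and it determines the component of `wt lam`
  outside `ℤ δ` if `p > 0`.
* The binomials in `h_1 + ⋯ + h_N` (`exists_kostant_choose_sum`). Modulo `p` their eigenvalues
  determine the integer `∑ lam i` (`int_eq_of_choose_eq`), hence `∑ (-1)^{v i} a_i`. Since the
  residues of the `a_i` are under control, the signed sum of the quotients `⌊(a_i - 1) / p⌋`, which
  is the coefficient of `-δ`, is determined as well (`sum_gam_eq`).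
-/

noncomputable section

namespace SuperGL

/-! ### Powers of the matrix of generators -/

section Gelfand

variable {N : ℕ} (v : Fin N → ZMod 2) {R : Type*} [Ring R]

/-- A family of elements of a ring that satisfies the defining relations of the matrix units of
the general linear Lie superalgebra. -/
def IsMatrixUnits (E : Fin N → Fin N → R) : Prop :=
  ∀ i j a b, E i j * E a b - sgn ((v i + v j) * (v a + v b)) • (E a b * E i j) =
    (if j = a then E i b else 0) - sgn ((v i + v j) * (v a + v b)) • (if i = b then E a j else 0)

/-- The entries of the `r`-th power of the matrix `E`, with the signs `(-1)^{v c}` at the summation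
indices that make the entries transform like `E` itself under supercommutators. The power for
`r = 0` is `diag((-1)^{v a})` and the power for `r = 1` is `E`. -/
def matPow (E : Fin N → Fin N → R) : ℕ → Fin N → Fin N → R
  | 0 => fun a b => if a = b then (sgn (v a) : R) else 0
  | r + 1 => fun a b => ∑ c, sgn (v c) • (E a c * matPow E r c b)

/-- The Gelfand invariant: the trace of the `r`-th power of the matrix of generators. -/
def gelfand (E : Fin N → Fin N → R) (r : ℕ) : R := ∑ a, matPow v E r a a

variable {v} {E : Fin N → Fin N → R}

theorem sgn_self_add_mul (a b : ZMod 2) : sgn ((a + b) * (a + b)) * sgn b = sgn a := by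
  revert a b; decide

/-- The entries of the powers of the matrix of generators transform under supercommutators with the
matrix units like the matrix units themselves. -/
theorem matPow_bracket (hE : IsMatrixUnits v E) (r : ℕ) (i j a b : Fin N) :
    E i j * matPow v E r a b - sgn ((v i + v j) * (v a + v b)) • (matPow v E r a b * E i j) =
      (if j = a then matPow v E r i b else 0)
        - sgn ((v i + v j) * (v a + v b)) • (if i = b then matPow v E r a j else 0) := by
  induction r generalizing a b with
  | zero =>
    simp only [matPow]
    by_cases hab : a = b
    · subst hab
      have h0 : v a + v a = 0 := CharTwo.add_self_eq_zero _
      simp only [if_true, h0, mul_zero, sgn_zero, one_smul]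
      rw [(Int.cast_commute (sgn (v a)) (E i j)).eq, sub_self]
      by_cases hia : i = a <;> by_cases hja : j = a <;> simp_all [eq_comm]
    · by_cases hja : j = a <;> by_cases hib : i = b
      · subst hja hib
        have h1 : sgn ((v i + v j) * (v j + v i)) * sgn (v j) = sgn (v i) := by
          rw [add_comm (v j), sgn_self_add_mul]
        simp only [if_true, if_neg hab]
        rw [zsmul_eq_mul (sgn (v j) : R), ← Int.cast_mul, h1]
        simp
      · subst hja; simp [hab, hib]
      · subst hib
        simp [hab, hja, eq_comm]
      · simp [hab, hja, hib]
  | succ r ih =>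
    simp only [matPow]
    -- the Leibniz rule for the supercommutator; the two middle terms cancel after summation
    have key : ∀ c, sgn (v c) • (E i j * (E a c * matPow v E r c b))
        - sgn ((v i + v j) * (v a + v b)) • (sgn (v c) • (E a c * matPow v E r c b * E i j)) =
        (if j = a then sgn (v c) • (E i c * matPow v E r c b) else 0)
        - (if i = c then (sgn (v i) * sgn ((v i + v j) * (v a + v i)))
            • (E a j * matPow v E r i b) else 0)
        + (if j = c then (sgn (v j) * sgn ((v i + v j) * (v a + v j)))
            • (E a j * matPow v E r i b) else 0)
        - sgn ((v i + v j) * (v a + v b))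
            • (if i = b then sgn (v c) • (E a c * matPow v E r c j) else 0) := by
      intro c
      have hs : sgn ((v i + v j) * (v a + v b))
          = sgn ((v i + v j) * (v a + v c)) * sgn ((v i + v j) * (v c + v b)) := by
        generalize v i = i', v j = j', v a = a', v b = b', v c = c'
        revert i' j' a' b' c'; decide
      have h1 := congrArg (fun t => sgn (v c) • (t * matPow v E r c b)) (hE i j a c)
      have h2 := congrArg
        (fun t => (sgn (v c) * sgn ((v i + v j) * (v a + v c))) • (E a c * t)) (ih c b)
      have h3 := congrArg₂ (· + ·) h1 h2
      refine Eq.trans ?_ (h3.trans ?_)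
      · rw [hs]
        simp only [sub_mul, mul_sub, smul_sub, smul_mul_assoc, mul_smul_comm, smul_smul,
          mul_assoc]
        rw [mul_comm (sgn ((v i + v j) * (v a + v c))) (sgn ((v i + v j) * (v c + v b)) * sgn (v c)),
          mul_comm (sgn ((v i + v j) * (v c + v b))) (sgn (v c)), mul_assoc,
          mul_comm (sgn ((v i + v j) * (v c + v b)))]
        abel
      · have t1 : sgn (v c) • ((if j = a then E i c else 0) * matPow v E r c b) =
            if j = a then sgn (v c) • (E i c * matPow v E r c b) else 0 := by
          split_ifs <;> simp
        have t2 : sgn (v c) • ((sgn ((v i + v j) * (v a + v c)) • if i = c then E a j else 0)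
            * matPow v E r c b) = if i = c then (sgn (v i) * sgn ((v i + v j) * (v a + v i)))
              • (E a j * matPow v E r i b) else 0 := by
          split_ifs with h
          · subst h; rw [smul_mul_assoc, smul_smul]
          · simp
        have t3 : (sgn (v c) * sgn ((v i + v j) * (v a + v c)))
            • (E a c * if j = c then matPow v E r i b else 0) =
            if j = c then (sgn (v j) * sgn ((v i + v j) * (v a + v j)))
              • (E a j * matPow v E r i b) else 0 := by
          split_ifs with h
          · subst h; rfl
          · simp
        have t4 : (sgn (v c) * sgn ((v i + v j) * (v a + v c))) • (E a c *
            (sgn ((v i + v j) * (v c + v b)) • if i = b then matPow v E r c j else 0)) =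
            sgn ((v i + v j) * (v a + v b))
              • (if i = b then sgn (v c) • (E a c * matPow v E r c j) else 0) := by
          rw [hs]
          split_ifs
          · rw [mul_smul_comm, smul_smul, smul_smul]
            exact congrArg (fun t : ℤ => t • _) (by ring)
          · simp
        rw [sub_mul, smul_sub, mul_sub, smul_sub, t1, t2, t3, t4]
        abel
    rw [Finset.mul_sum, Finset.sum_mul, Finset.smul_sum, ← Finset.sum_sub_distrib]
    simp only [mul_smul_comm, smul_mul_assoc]
    rw [Finset.sum_congr rfl fun c _ => key c]
    have hsg : sgn (v i) * sgn ((v i + v j) * (v a + v i))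
        = sgn (v j) * sgn ((v i + v j) * (v a + v j)) := by
      generalize v i = i', v j = j', v a = a'
      revert i' j' a'; decide
    simp only [Finset.sum_add_distrib, Finset.sum_sub_distrib, Finset.sum_ite_eq,
      Finset.mem_univ, if_true, hsg, ← Finset.smul_sum]
    split_ifs <;> simp

theorem commute_gelfand (hE : IsMatrixUnits v E) (r : ℕ) (i j : Fin N) :
    Commute (E i j) (gelfand v E r) := by
  rw [commute_iff_eq, ← sub_eq_zero, gelfand, Finset.mul_sum, Finset.sum_mul,
    ← Finset.sum_sub_distrib]
  have h : ∀ a, E i j * matPow v E r a a - matPow v E r a a * E i j =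
      (if j = a then matPow v E r i a else 0) - (if i = a then matPow v E r a j else 0) := by
    intro a
    have := matPow_bracket hE r i j a a
    rwa [CharTwo.add_self_eq_zero, mul_zero, sgn_zero, one_smul, one_smul] at this
  rw [Finset.sum_congr rfl fun a _ => h a]
  simp

theorem map_gelfand {S : Type*} [Ring S] (f : R →+* S) (r : ℕ) :
    f (gelfand v E r) = gelfand v (fun a b => f (E a b)) r := by
  have h : ∀ r a b, f (matPow v E r a b) = matPow v (fun a b => f (E a b)) r a b := by
    intro r
    induction r with
    | zero => intro a b; simp [matPow, apply_ite f]
    | succ r ih => intro a b; simp [matPow, map_sum, ih]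
  simp [gelfand, map_sum, h]

/-- The diagonal entry of the recursion for the eigenvalues: `(lam + ρ, ε_a)` for odd `v a`, and one
less for even `v a` (`form_add_rho`). -/
def diagEntry (v : Fin N → ZMod 2) (lam : Fin N → ℤ) (a : Fin N) : ℤ :=
  sgn (v a) * lam a + ∑ c ∈ Finset.Ioi a, sgn (v c)

/-- The eigenvalues of the diagonal entries `matPow v E r a a` on a highest weight vector of
weight `lam`, multiplied by the sign `(-1)^{v a}`. -/
def diagEig (v : Fin N → ZMod 2) (lam : Fin N → ℤ) : ℕ → Fin N → ℤ
  | 0 => fun _ => 1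
  | r + 1 => fun a => diagEntry v lam a * diagEig v lam r a
      - ∑ c ∈ Finset.Ioi a, sgn (v c) * diagEig v lam r c

/-- A power of the matrix of generators is lower triangular on a highest weight vector, with
diagonal entries given by a linear recursion. -/
theorem matPow_smul (hE : IsMatrixUnits v E) {M : Type*} [AddCommGroup M] [Module R M] {x : M}
    {lam : Fin N → ℤ} (hx : ∀ i j, i < j → E i j • x = 0) (hl : ∀ i, E i i • x = lam i • x)
    (r : ℕ) :
    (∀ a b, a < b → matPow v E r a b • x = 0) ∧
      ∀ a, matPow v E r a a • x = (sgn (v a) * diagEig v lam r a) • x := by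
  induction r with
  | zero =>
    refine ⟨fun a b hab => by simp [matPow, hab.ne], fun a => ?_⟩
    simp [matPow, diagEig, Int.cast_smul_eq_zsmul]
  | succ r ih =>
    obtain ⟨ih1, ih2⟩ := ih
    have hbr : ∀ a c b, a < c → E a c • matPow v E r c b • x
        = matPow v E r a b • x - sgn ((v a + v c) * (v c + v b)) •
          (if a = b then matPow v E r c c else 0) • x := by
      intro a c b hac
      have h := congrArg (fun t => t • x) (matPow_bracket hE r a c c b)
      simp only [if_true, sub_smul, mul_smul, smul_assoc, hx a c hac, smul_zero, sub_zero] at h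
      exact h
    constructor
    · intro a b hab
      simp only [matPow, Finset.sum_smul, smul_assoc, mul_smul]
      refine Finset.sum_eq_zero fun c _ => ?_
      rcases lt_or_ge c b with hcb | hbc
      · rw [ih1 c b hcb]; simp
      · rw [hbr a c b (hab.trans_le hbc), ih1 a b hab]
        simp [hab.ne]
    · intro a
      simp only [matPow, Finset.sum_smul, smul_assoc, mul_smul]
      have hterm : ∀ c, sgn (v c) • E a c • matPow v E r c a • x =
          (if a = c then (lam a * diagEig v lam r a) • x else 0) +
          (if a < c then (sgn (v c) * sgn (v a) * diagEig v lam r a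
            - sgn (v a) * sgn (v c) * diagEig v lam r c) • x else 0) := by
        intro c
        rcases lt_trichotomy c a with h | rfl | h
        · rw [ih1 c a h]; simp [h.ne', h.not_gt]
        · rw [ih2, smul_comm (E c c), hl]
          simp only [smul_smul, if_true, lt_irrefl, if_false, add_zero]
          congr 1
          linear_combination (diagEig v lam r c * lam c) * sgn_mul_self (v c)
        · rw [hbr a c a h, ih2 a]
          simp only [if_true, ih2 c, h, h.ne, if_false, zero_add, smul_sub, smul_smul, sub_smul]
          have hs : sgn (v c) * (sgn ((v a + v c) * (v c + v a)) * (sgn (v c)))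
              = sgn (v a) * sgn (v c) := by
            generalize v a = a', v c = c'
            revert a' c'; decide
          rw [← mul_assoc, ← hs]
          simp only [mul_assoc]
      rw [Finset.sum_congr rfl fun c _ => hterm c, Finset.sum_add_distrib, Finset.sum_ite_eq,
        if_pos (Finset.mem_univ a), ← Finset.sum_filter, ← Finset.sum_smul, ← add_smul,
        Finset.filter_lt_eq_Ioi, smul_smul]
      refine congrArg (fun t : ℤ => t • x) ?_
      have hrec : diagEig v lam (r + 1) a = diagEntry v lam a * diagEig v lam r a
        - ∑ c ∈ Finset.Ioi a, sgn (v c) * diagEig v lam r c := rfl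
      rw [Finset.sum_sub_distrib, hrec, diagEntry, mul_sub, add_mul, mul_add, Finset.sum_mul,
        Finset.mul_sum, Finset.mul_sum]
      rw [Finset.sum_congr rfl fun c _ =>
        (by ring : sgn (v c) * sgn (v a) * diagEig v lam r a
          = sgn (v a) * (sgn (v c) * diagEig v lam r a)),
        Finset.sum_congr rfl fun c _ =>
        (by ring : sgn (v a) * sgn (v c) * diagEig v lam r c
          = sgn (v a) * (sgn (v c) * diagEig v lam r c))]
      linear_combination (-(diagEig v lam r a * lam a)) * sgn_mul_self (v a)

/-- The Gelfand invariants act on a highest weight vector by integers. -/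
theorem gelfand_smul (hE : IsMatrixUnits v E) {M : Type*} [AddCommGroup M] [Module R M] {x : M}
    {lam : Fin N → ℤ} (hx : ∀ i j, i < j → E i j • x = 0) (hl : ∀ i, E i i • x = lam i • x)
    (r : ℕ) :
    gelfand v E r • x = (∑ a, sgn (v a) * diagEig v lam r a) • x := by
  rw [gelfand, Finset.sum_smul, Finset.sum_smul]
  exact Finset.sum_congr rfl fun a _ => (matPow_smul hE hx hl r).2 a

end Gelfand

/-! ### The generating function of the eigenvalues -/

section GeneratingFunction

open PowerSeries

variable {N : ℕ} (v : Fin N → ZMod 2) (K : Type*)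

/-- The generating function `∑ r, diagEig v lam r a * X ^ r`. -/
def eigSeries [CommRing K] (lam : Fin N → ℤ) (a : Fin N) : K⟦X⟧ :=
  PowerSeries.mk fun r => (diagEig v lam r a : K)

variable {v} {K}

theorem eigSeries_rec [CommRing K] (lam : Fin N → ℤ) (a : Fin N) :
    eigSeries v K lam a = 1 + X * (C (diagEntry v lam a : K) * eigSeries v K lam a
      - ∑ c ∈ Finset.Ioi a, C (sgn (v c) : K) * eigSeries v K lam c) := by
  ext r
  rcases r with _ | r
  · simp [eigSeries, diagEig]
  · have h : diagEig v lam (r + 1) a = diagEntry v lam a * diagEig v lam r a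
      - ∑ c ∈ Finset.Ioi a, sgn (v c) * diagEig v lam r c := rfl
    rw [map_add, coeff_succ_X_mul, map_sub, map_sum]
    simp [eigSeries, h, coeff_one, coeff_C_mul, -map_intCast]

/-- Back-substitution in the triangular system `eigSeries_rec` turns the generating function of
the eigenvalues of the Gelfand invariants into a product. -/
theorem eigSeries_prod [CommRing K] (lam : Fin N → ℤ) :
    (1 - X * ∑ a, C (sgn (v a) : K) * eigSeries v K lam a)
        * ∏ a, (1 - X * C (diagEntry v lam a : K)) =
      ∏ a, (1 - X * C ((diagEntry v lam a + sgn (v a) : ℤ) : K)) := by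
  -- the partial products over the final segments `s` of the index set
  suffices h : ∀ s : Finset (Fin N), (∀ a ∈ s, Finset.Ioi a ⊆ s) →
      (1 - X * ∑ a ∈ s, C (sgn (v a) : K) * eigSeries v K lam a)
        * ∏ a ∈ s, (1 - X * C (diagEntry v lam a : K)) =
      ∏ a ∈ s, (1 - X * C ((diagEntry v lam a + sgn (v a) : ℤ) : K)) from
    h _ fun a _ => Finset.subset_univ _
  intro s
  induction s using Finset.induction_on_min with
  | empty => simp
  | insert a s has ih =>
    intro hup
    have ha : a ∉ s := fun h => lt_irrefl a (has a h)
    have hs : s = Finset.Ioi a := by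
      ext x
      rw [Finset.mem_Ioi]
      refine ⟨has x, fun hx => ?_⟩
      exact (Finset.mem_insert.1 (hup a (Finset.mem_insert_self a s)
        (Finset.mem_Ioi.2 hx))).resolve_left hx.ne'
    have ih' := ih fun x hx y hy => by
      rw [hs, Finset.mem_Ioi] at *
      exact hx.trans hy
    rw [Finset.sum_insert ha, Finset.prod_insert ha, Finset.prod_insert ha, ← ih']
    have hrec := eigSeries_rec (v := v) (K := K) lam a
    rw [← hs] at hrec
    push_cast [map_add]
    linear_combination (-(X * C (sgn (v a) : K)
      * ∏ a ∈ s, (1 - X * C (diagEntry v lam a : K)))) * hrec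

/-- The product of `1 - x X` over a multiset of scalars of known size determines the multiset. -/
theorem multiset_eq_of_prod_eq [Field K] {s t : Multiset K} (hc : s.card = t.card)
    (h : (s.map fun x => (1 - X * C x : K⟦X⟧)).prod = (t.map fun x => 1 - X * C x).prod) :
    s = t := by
  -- the product as a polynomial, evaluated at the inverse of the indeterminate
  let P : Multiset K → Polynomial K := fun s =>
    (s.map fun x => 1 - Polynomial.X * Polynomial.C x).prod
  have hP : ∀ s : Multiset K, (s.map fun x => (1 - X * C x : K⟦X⟧)).prod = (P s : K⟦X⟧) := by
    intro s
    rw [← Polynomial.coeToPowerSeries.ringHom_apply, map_multiset_prod, Multiset.map_map]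
    refine congrArg Multiset.prod (Multiset.map_congr rfl fun x _ => ?_)
    rw [Function.comp_apply, Polynomial.coeToPowerSeries.ringHom_apply, Polynomial.coe_sub,
      Polynomial.coe_mul, Polynomial.coe_one, Polynomial.coe_X, Polynomial.coe_C]
  have hPst : P s = P t := by
    rw [hP, hP] at h
    exact Polynomial.coe_injective K h
  let Y : RatFunc K := algebraMap (Polynomial K) (RatFunc K) Polynomial.X
  have hY : Y ≠ 0 := by
    simp [Y, RatFunc.X_ne_zero]
  have key : ∀ s : Multiset K, algebraMap (Polynomial K) (RatFunc K)
      (s.map fun x => Polynomial.X - Polynomial.C x).prod =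
      Y ^ s.card * Polynomial.aeval Y⁻¹ (P s) := by
    intro s
    induction s using Multiset.induction_on with
    | empty => simp [P]
    | cons x s ih =>
      have hcons : P (x ::ₘ s) = (1 - Polynomial.X * Polynomial.C x) * P s := by simp [P]
      have hx : Y * Polynomial.aeval Y⁻¹ (1 - Polynomial.X * Polynomial.C x) =
          algebraMap (Polynomial K) (RatFunc K) (Polynomial.X - Polynomial.C x) := by
        simp only [map_sub, map_mul, map_one, Polynomial.aeval_X, Polynomial.aeval_C]
        rw [mul_sub, ← mul_assoc, mul_inv_cancel₀ hY, mul_one, one_mul]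
        rfl
      rw [hcons, Multiset.map_cons, Multiset.prod_cons, map_mul, ih, Multiset.card_cons, map_mul,
        ← hx]
      ring
  have h2 : (s.map fun x => Polynomial.X - Polynomial.C x).prod
      = (t.map fun x => Polynomial.X - Polynomial.C x).prod := by
    apply RatFunc.algebraMap_injective K
    rw [key, key, hPst, hc]
  rw [← Polynomial.roots_multiset_prod_X_sub_C s, h2, Polynomial.roots_multiset_prod_X_sub_C]

/-- Equal eigenvalues of the Gelfand invariants on two highest weight vectors give an identity
between the multisets of zeros and poles of the two generating functions. -/
theorem sum_single_eq_of_eig_eq [Field K] {lam mu : Fin N → ℤ}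
    (h : ∀ r, ((∑ a, sgn (v a) * diagEig v lam r a : ℤ) : K)
      = ((∑ a, sgn (v a) * diagEig v mu r a : ℤ) : K)) :
    ∑ a, (Finsupp.single ((diagEntry v lam a + sgn (v a) : ℤ) : K) (1 : ℤ)
        - Finsupp.single (diagEntry v lam a : K) 1) =
      ∑ a, (Finsupp.single ((diagEntry v mu a + sgn (v a) : ℤ) : K) (1 : ℤ)
        - Finsupp.single (diagEntry v mu a : K) 1) := by
  have hZ : ∑ a, C (sgn (v a) : K) * eigSeries v K lam a
      = ∑ a, C (sgn (v a) : K) * eigSeries v K mu a := by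
    ext r
    have := h r
    push_cast at this
    simpa [eigSeries, coeff_C_mul, -map_intCast] using this
  have hl := eigSeries_prod (v := v) (K := K) lam
  have hm := eigSeries_prod (v := v) (K := K) mu
  rw [hZ] at hl
  let B : (Fin N → ℤ) → Multiset K := fun lam =>
    Finset.univ.val.map fun a => (diagEntry v lam a : K)
  let T : (Fin N → ℤ) → Multiset K := fun lam =>
    Finset.univ.val.map fun a => ((diagEntry v lam a + sgn (v a) : ℤ) : K)
  have hms : T lam + B mu = T mu + B lam := by
    apply multiset_eq_of_prod_eq
    · simp [T, B]
    · simp only [Multiset.map_add, Multiset.prod_add, T, B, Multiset.map_map, Function.comp_def]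
      change (∏ a, (1 - X * C ((diagEntry v lam a + sgn (v a) : ℤ) : K))) *
          (∏ a, (1 - X * C (diagEntry v mu a : K))) =
        (∏ a, (1 - X * C ((diagEntry v mu a + sgn (v a) : ℤ) : K))) *
          (∏ a, (1 - X * C (diagEntry v lam a : K)))
      rw [← hl, ← hm]
      ring
  have hsum := congrArg (fun s : Multiset K =>
    (s.map fun x => Finsupp.single x (1 : ℤ)).sum) hms
  simp only [Multiset.map_add, Multiset.sum_add, T, B, Multiset.map_map, Function.comp_def]
    at hsum
  rw [Finset.sum_sub_distrib, Finset.sum_sub_distrib, sub_eq_sub_iff_add_eq_add]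
  exact hsum

/-- An integer is determined by its binomials, even modulo `p`: they are the coefficients of
`(1 + X) ^ d`, and `(1 + X) ^ n ≠ 1` for `n > 0` over any field. -/
theorem int_eq_of_choose_eq [Field K] {d d' : ℤ}
    (h : ∀ r, ((Ring.choose d r : ℤ) : K) = ((Ring.choose d' r : ℤ) : K)) : d = d' := by
  wlog hdd : d' ≤ d generalizing d d'
  · exact (this (fun r => (h r).symm) (le_of_not_ge hdd)).symm
  obtain ⟨n, rfl⟩ := Int.le.dest hdd
  have hB : binomialSeries K (d' + (n : ℤ)) = binomialSeries K d' := by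
    ext r
    rw [binomialSeries_coeff, binomialSeries_coeff, zsmul_one, zsmul_one, h r]
  rw [binomialSeries_add] at hB
  have h0 : binomialSeries K d' ≠ 0 := by
    intro h0
    have := binomialSeries_constantCoeff (A := K) d'
    rw [h0, map_zero] at this
    exact zero_ne_one this
  have h1 : binomialSeries K (n : ℤ) = 1 := mul_left_cancel₀ h0 (by rw [hB, mul_one])
  have h2 : ((Ring.choose (n : ℤ) n : ℤ) : K) = coeff n (1 : K⟦X⟧) := by
    rw [← h1, binomialSeries_coeff, zsmul_one]
  rw [Ring.choose_natCast, Nat.choose_self, coeff_one] at h2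
  by_cases hn : n = 0
  · simp [hn]
  · simp [hn] at h2

end GeneratingFunction

/-! ### From eigenvalues to the weight function -/

section WeightFunction

/-- A signed multiset of residues is determined by its size `∑ i, s i` and its difference
derivative: the difference of two of them is constant, hence zero if `p = 0`, because it has finite
support, and zero if `p > 0`, because its values sum to zero. -/
theorem sum_single_zmod_eq {ι K : Type*} [Fintype ι] [Field K] (p : ℕ) [CharP K p] {s a a' : ι → ℤ}
    (h : ∑ i, s i • (Finsupp.single (a i : K) (1 : ℤ) - Finsupp.single ((a i - 1 : ℤ) : K) 1) =
      ∑ i, s i • (Finsupp.single (a' i : K) (1 : ℤ) - Finsupp.single ((a' i - 1 : ℤ) : K) 1)) :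
    ∑ i, s i • Finsupp.single (a i : ZMod p) (1 : ℤ) =
      ∑ i, s i • Finsupp.single (a' i : ZMod p) 1 := by
  classical
  set D : ZMod p →₀ ℤ := ∑ i, s i • Finsupp.single (a i : ZMod p) (1 : ℤ)
    - ∑ i, s i • Finsupp.single (a' i : ZMod p) 1 with hD
  have hcast : ∀ x y : ℤ, (x : K) = y ↔ (x : ZMod p) = y := fun x y => by
    rw [CharP.intCast_eq_intCast K p, ZMod.intCast_eq_intCast_iff]
  have hstep : ∀ x : ℤ, D ((x + 1 : ℤ) : ZMod p) = D (x : ZMod p) := by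
    intro x
    have hx := DFunLike.congr_fun h (x : K)
    simp only [Finsupp.finsetSum_apply, Finsupp.smul_apply, Finsupp.sub_apply,
      Finsupp.single_apply, hcast, smul_sub, Finset.sum_sub_distrib] at hx
    have hshift : ∀ y : ℤ, ((y - 1 : ℤ) : ZMod p) = x ↔ (y : ZMod p) = ((x + 1 : ℤ) : ZMod p) := by
      intro y; push_cast; rw [sub_eq_iff_eq_add]
    simp only [hshift] at hx
    simp only [hD, Finsupp.sub_apply, Finsupp.finsetSum_apply, Finsupp.smul_apply,
      Finsupp.single_apply]
    linarith
  have hconst : ∀ x : ZMod p, D x = D 0 := by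
    intro x
    obtain ⟨n, rfl⟩ := ZMod.intCast_surjective x
    induction n using Int.induction_on with
    | zero => simp
    | succ n ih => rw [hstep, ih]
    | pred n ih => rw [← ih, ← hstep, sub_add_cancel]
  suffices h0 : D 0 = 0 by
    refine sub_eq_zero.1 (Finsupp.ext fun x => ?_)
    exact (hconst x).trans h0
  rcases Nat.eq_zero_or_pos p with rfl | hp
  · obtain ⟨x, hx⟩ := Infinite.exists_notMem_finset (α := ℤ) D.support
    rw [← hconst x]
    exact Finsupp.notMem_support_iff.1 hx
  · have : NeZero p := ⟨hp.ne'⟩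
    have hsum : ∑ x, D x = 0 := by
      simp only [hD, Finsupp.sub_apply, Finsupp.finsetSum_apply, Finsupp.smul_apply,
        Finset.sum_sub_distrib]
      rw [Finset.sum_comm, Finset.sum_comm (s := Finset.univ (α := ZMod p))]
      simp [Finsupp.single_apply]
    rw [Finset.sum_congr rfl fun x _ => hconst x] at hsum
    simpa [hp.ne'] using hsum

/-- The signed sum of the `γ_{a i}` is determined by the difference derivative of the signed multiset
of residues together with the signed sum of the integers `a i`. -/
theorem sum_gam_eq {ι K : Type*} [Fintype ι] [Field K] (p : ℕ) [CharP K p] {s a a' : ι → ℤ}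
    (h : ∑ i, s i • (Finsupp.single (a i : K) (1 : ℤ) - Finsupp.single ((a i - 1 : ℤ) : K) 1) =
      ∑ i, s i • (Finsupp.single (a' i : K) (1 : ℤ) - Finsupp.single ((a' i - 1 : ℤ) : K) 1))
    (hsum : ∑ i, s i * a i = ∑ i, s i * a' i) :
    ∑ i, s i • gam p (a i) = ∑ i, s i • gam p (a' i) := by
  have hD := sum_single_zmod_eq p h
  rcases p with _ | q
  · exact hD
  · have hmap : ∀ {M : Type} [AddCommGroup M] (f : ZMod (q + 1) → M),
        ∑ i, s i • f (a i) = ∑ i, s i • f (a' i) := by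
      intro M _ f
      have := congrArg (Finsupp.linearCombination ℤ f) hD
      simpa [map_sum] using this
    refine Prod.ext ?_ ?_
    · have hfst : ∀ b : ι → ℤ, (∑ i, s i • gam (q + 1) (b i)).1
          = ∑ i, s i • (-((b i - 1) / ((q + 1 : ℕ) : ℤ))) := fun b => by
        refine (map_sum
          (AddMonoidHom.fst ℤ (ZMod (q + 1) →₀ ℤ) : Lattice (q + 1) →+ ℤ) _ _).trans ?_
        exact Finset.sum_congr rfl fun i _ => map_zsmul
          (AddMonoidHom.fst ℤ (ZMod (q + 1) →₀ ℤ) : Lattice (q + 1) →+ ℤ) _ _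
      rw [hfst, hfst]
      -- `b - 1 = (q + 1) * ((b - 1) / (q + 1)) + (b - 1) % (q + 1)`, with residues known from `hD`
      have hval := hmap fun x => ((x - 1).val : ℤ)
      have hmod : ∀ b : ℤ, (((b : ZMod (q + 1)) - 1).val : ℤ)
          = (b - 1) - ((q + 1 : ℕ) : ℤ) * ((b - 1) / ((q + 1 : ℕ) : ℤ)) := fun b => by
        rw [← Int.emod_def, ← ZMod.val_intCast]
        push_cast
        rfl
      simp only [hmod, smul_eq_mul, mul_sub, Finset.sum_sub_distrib, hsum] at hval
      have h1 := sub_right_inj.1 hval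
      have hq : ((q + 1 : ℕ) : ℤ) ≠ 0 := by positivity
      simp only [mul_left_comm _ ((q + 1 : ℕ) : ℤ), ← Finset.mul_sum] at h1
      simp only [smul_eq_mul, mul_neg, Finset.sum_neg_distrib]
      rw [mul_left_cancel₀ hq h1]
    · have hsnd : ∀ b : ι → ℤ, (∑ i, s i • gam (q + 1) (b i)).2
          = ∑ i, s i • (Finsupp.single (b i : ZMod (q + 1)) (1 : ℤ)
            - Finsupp.single ((b i : ZMod (q + 1)) - 1) 1) := fun b => by
        refine (map_sum (AddMonoidHom.snd ℤ (ZMod (q + 1) →₀ ℤ) :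
          Lattice (q + 1) →+ (ZMod (q + 1) →₀ ℤ)) _ _).trans ?_
        exact Finset.sum_congr rfl fun i _ => map_zsmul
          (AddMonoidHom.snd ℤ (ZMod (q + 1) →₀ ℤ) : Lattice (q + 1) →+ (ZMod (q + 1) →₀ ℤ)) _ _
      rw [hsnd, hsnd]
      exact hmap fun x => Finsupp.single x (1 : ℤ) - Finsupp.single (x - 1) 1

variable {N : ℕ} (v : Fin N → ZMod 2)

theorem form_add_rho (lam : Fin N → ℤ) (a : Fin N) :
    form v (lam + rho v) (Pi.single a 1) = diagEntry v lam a + if v a = 0 then 1 else 0 := by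
  have hs : ∀ c, sgn (v a) * sgn (v c + v a) = sgn (v c) := fun c => by
    rw [add_comm, sgn_add, ← mul_assoc, sgn_mul_self, one_mul]
  have hi : sgn (v a) * (if v a = 0 then 1 else 0) = if v a = 0 then 1 else 0 := by
    split_ifs with h
    · rw [h, sgn_zero, one_mul]
    · rw [mul_zero]
  rw [form, Finset.sum_eq_single a (fun b _ hb => by simp [hb]) (by simp)]
  rw [Pi.single_eq_same, mul_one, Pi.add_apply, rho, diagEntry, mul_add, mul_add, hi,
    Finset.mul_sum, Finset.sum_congr rfl fun c _ => hs c, add_assoc]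

/-- The eigenvalues of the Gelfand invariants and the degree `∑ i, lam i` determine the weight
function. -/
theorem wt_eq_of_eig_eq {K : Type*} [Field K] (p : ℕ) [CharP K p] {lam mu : Weight N}
    (h : ∀ r, ((∑ a, sgn (v a) * diagEig v lam r a : ℤ) : K)
      = ((∑ a, sgn (v a) * diagEig v mu r a : ℤ) : K))
    (hdeg : ∑ i, lam i = ∑ i, mu i) : wt v p lam = wt v p mu := by
  refine sum_gam_eq (K := K) p ?_ ?_
  · have key : ∀ lam : Weight N, ∑ a, (Finsupp.single ((diagEntry v lam a + sgn (v a) : ℤ) : K)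
        (1 : ℤ) - Finsupp.single (diagEntry v lam a : K) 1) =
        ∑ i, sgn (v i) • (Finsupp.single (form v (lam + rho v) (Pi.single i 1) : K) (1 : ℤ)
          - Finsupp.single ((form v (lam + rho v) (Pi.single i 1) - 1 : ℤ) : K) 1) := by
      intro lam
      refine Finset.sum_congr rfl fun i _ => ?_
      rw [form_add_rho]
      by_cases hi : v i = 0
      · rw [if_pos hi, hi, sgn_zero, one_smul, add_sub_cancel_right]
      · rw [if_neg hi, sgn, if_neg hi, add_zero, neg_smul, one_smul, neg_sub, ← sub_eq_add_neg]
    rw [← key, ← key]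
    exact sum_single_eq_of_eig_eq h
  · have key : ∀ lam : Weight N, ∑ i, sgn (v i) * form v (lam + rho v) (Pi.single i 1)
        = ∑ i, lam i + ∑ i, rho v i := by
      intro lam
      rw [← Finset.sum_add_distrib]
      refine Finset.sum_congr rfl fun i _ => ?_
      rw [form, Finset.sum_eq_single i (fun b _ hb => by simp [hb]) (by simp), Pi.single_eq_same,
        mul_one, Pi.add_apply, ← mul_assoc, sgn_mul_self, one_mul]
    rw [key, key, hdeg]

end WeightFunction

/-! ### Splitting an extension by a central element -/

section Splitting

variable {k : Type u} [Field k] {A : Type u} [Ring A] [Algebra k A] {𝒜 : ZMod 2 → Submodule k A}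

namespace SuperMod

theorem isCompl_add_one (M : SuperMod 𝒜) (s : ZMod 2) : IsCompl (M.grade s) (M.grade (s + 1)) := by
  fin_cases s
  · exact M.isCompl
  · exact M.isCompl.symm

theorem exists_decomp_add_one (M : SuperMod 𝒜) (s : ZMod 2) (x : M.carrier) :
    ∃ y ∈ M.grade s, ∃ z ∈ M.grade (s + 1), y + z = x := by
  have : x ∈ M.grade s ⊔ M.grade (s + 1) := by rw [(M.isCompl_add_one s).sup_eq_top]; trivial
  exact Submodule.mem_sup.1 this

theorem eq_zero_of_mem {M : SuperMod 𝒜} {s : ZMod 2} {x : M.carrier} (h : x ∈ M.grade s)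
    (h' : x ∈ M.grade (s + 1)) : x = 0 :=
  (Submodule.disjoint_def.1 (M.isCompl_add_one s).disjoint) x h h'

/-- The homogeneous component of a preimage of a homogeneous element is again a preimage. -/
theorem exists_homogeneous_preimage {M N : SuperMod 𝒜} (f : M.carrier →ₗ[A] N.carrier)
    (hf : ∀ s, ∀ x ∈ M.grade s, f x ∈ N.grade s) {s : ZMod 2} {x : M.carrier}
    (hx : f x ∈ N.grade s) : ∃ y ∈ M.grade s, f y = f x := by
  obtain ⟨y, hy, z, hz, rfl⟩ := M.exists_decomp_add_one s x
  refine ⟨y, hy, ?_⟩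
  have h1 : f z ∈ N.grade s := by
    have := sub_mem hx (hf s y hy)
    rwa [map_add, add_sub_cancel_left] at this
  rw [map_add, eq_zero_of_mem h1 (hf _ z hz), add_zero]

/-- An extension of `M` by `N` splits if some even central element acts by `1` on `M` and by `0`
on `N`: the action of this element on the middle term factors through a section. -/
theorem evenExt1_eq_zero_of_idempotent {M N : SuperMod 𝒜} {w : A} (hw : w ∈ 𝒜 0)
    (hc : ∀ a, Commute w a) (hM : ∀ x : M.carrier, w • x = x) (hN : ∀ x : N.carrier, w • x = 0)
    (ξ : EvenExt1 M N) : ξ = 0 := by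
  induction ξ using Quotient.ind with
  | _ X =>
  refine Quotient.sound (Setoid.symm ?_)
  let f : X.E.carrier →ₗ[A] X.E.carrier :=
    { toFun := fun x => w • x
      map_add' := smul_add w
      map_smul' := fun a x => by
        rw [smul_smul, (hc a).eq, mul_smul]; rfl }
  have hker : LinearMap.ker X.q ≤ LinearMap.ker f := by
    intro x hx
    obtain ⟨y, rfl⟩ := (X.exact x).1 hx
    change w • X.i y = 0
    rw [← map_smul, hN, map_zero]
  let t : M.carrier →ₗ[A] X.E.carrier :=
    ((LinearMap.ker X.q).liftQ f hker).comp
      (X.q.quotKerEquivOfSurjective X.q_surjective).symm.toLinearMap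
  have ht : ∀ x, t (X.q x) = w • x := by
    intro x
    have : (X.q.quotKerEquivOfSurjective X.q_surjective).symm (X.q x)
        = (LinearMap.ker X.q).mkQ x := by
      rw [LinearEquiv.symm_apply_eq]; rfl
    exact congrArg ((LinearMap.ker X.q).liftQ f hker) this
  have hqt : ∀ m, X.q (t m) = m := by
    intro m
    obtain ⟨x, rfl⟩ := X.q_surjective m
    rw [ht, map_smul, hM]
  have hqi : ∀ n, X.q (X.i n) = 0 := fun n => (X.exact _).2 ⟨n, rfl⟩
  have ht_even : ∀ s, ∀ m ∈ M.grade s, t m ∈ X.E.grade s := by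
    intro s m hm
    obtain ⟨x, rfl⟩ := X.q_surjective m
    obtain ⟨y, hy, hyx⟩ := exists_homogeneous_preimage X.q X.q_even hm
    rw [← hyx, ht]
    have := X.E.smul_mem hw hy
    rwa [zero_add] at this
  let g : (N.prod M).carrier →ₗ[A] X.E.carrier := LinearMap.coprod X.i t
  have hg : ∀ n m, g (n, m) = X.i n + t m := fun n m => LinearMap.coprod_apply _ _ _
  have hg_even : ∀ s, ∀ x ∈ (N.prod M).grade s, g x ∈ X.E.grade s := by
    rintro s ⟨n, m⟩ ⟨hn, hm⟩
    rw [hg]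
    exact add_mem (X.i_even s n hn) (ht_even s m hm)
  have hg_inj : Function.Injective g := by
    rw [injective_iff_map_eq_zero]
    rintro ⟨n, m⟩ h
    rw [hg] at h
    have hm : m = 0 := by
      have := congrArg X.q h
      rwa [map_add, hqi, hqt, zero_add, map_zero] at this
    rw [hm, map_zero, add_zero, ← map_zero X.i] at h
    rw [X.i_injective h, hm]
    rfl
  have hg_surj : Function.Surjective g := by
    intro x
    obtain ⟨n, hn⟩ := (X.exact (x - t (X.q x))).1 (by rw [map_sub, hqt, sub_self])
    exact ⟨(n, X.q x), by rw [hg, hn, sub_add_cancel]⟩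
  refine ⟨LinearEquiv.ofBijective g ⟨hg_inj, hg_surj⟩, fun s x => ⟨hg_even s x, fun h => ?_⟩,
    fun n => ?_, ?_⟩
  · obtain ⟨y, hy, hyx⟩ := exists_homogeneous_preimage g hg_even h
    rwa [← hg_inj hyx]
  · change g (n, 0) = _
    rw [hg, map_zero, add_zero]
  · rintro ⟨n, m⟩
    change X.q (g (n, m)) = m
    rw [hg, map_add, hqi, hqt, zero_add]

/-- Supermodules on which an even central element acts by different scalars have no nontrivial
extensions. -/
theorem evenExt1_eq_zero {M N : SuperMod 𝒜} (h1 : 1 ∈ 𝒜 0) {z : A} (hz : z ∈ 𝒜 0)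
    (hc : ∀ a, Commute z a) {c d : k} (hcd : c ≠ d) (hM : ∀ x : M.carrier, z • x = c • x)
    (hN : ∀ x : N.carrier, z • x = d • x) (ξ : EvenExt1 M N) : ξ = 0 := by
  refine evenExt1_eq_zero_of_idempotent (w := (c - d)⁻¹ • (z - d • 1))
    (Submodule.smul_mem _ _ (sub_mem hz (Submodule.smul_mem _ _ h1)))
    (fun a => ((hc a).sub_left ((Commute.one_left a).smul_left d)).smul_left _)
    (fun x => ?_) (fun x => ?_) ξ
  · rw [smul_assoc, sub_smul, smul_assoc, one_smul, hM, ← sub_smul, smul_smul,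
      inv_mul_cancel₀ (sub_ne_zero.2 hcd), one_smul]
  · rw [smul_assoc, sub_smul, smul_assoc, one_smul, hN, sub_self, smul_zero]

end SuperMod

end Splitting

/-! ### Central elements of the superalgebra of distributions -/

section Central

variable {N : ℕ} (v : Fin N → ZMod 2)

/-- The rational structure, which makes the binomials `Ring.choose x r` available in `Env v`. -/
instance : Module ℚ≥0 (Env v) := Module.compHom (Env v) (algebraMap ℚ≥0 ℂ)

theorem smeval_descPochhammer_eq_prod {R : Type*} [Ring R] (x : R) (r : ℕ) :
    (descPochhammer ℤ r).smeval x = ((List.range r).map fun t : ℕ => x - (t : R)).prod := by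
  induction r with
  | zero => simp
  | succ r ih =>
    rw [descPochhammer_succ_right, Polynomial.smeval_mul, ih, List.range_succ, List.map_append,
      List.prod_append, Polynomial.smeval_sub, Polynomial.smeval_X, pow_one,
      Polynomial.smeval_natCast, pow_zero, nsmul_one]
    simp

theorem choose_eq_inv_smul_prod (x : Env v) (r : ℕ) :
    Ring.choose x r =
      ((r.factorial : ℂ)⁻¹) • ((List.range r).map fun t : ℕ => x - (t : Env v)).prod := by
  rw [← smeval_descPochhammer_eq_prod, Ring.descPochhammer_eq_factorial_smul_choose,
    ← Nat.cast_smul_eq_nsmul ℂ, inv_smul_smul₀ (Nat.cast_ne_zero.2 r.factorial_ne_zero)]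

theorem hBinom_eq_choose (i : Fin N) (r : ℕ) : hBinom v i r = Ring.choose (e v i i) r :=
  (choose_eq_inv_smul_prod v _ r).symm

theorem commute_choose {x y : Env v} (h : Commute x y) (r : ℕ) : Commute (Ring.choose x r) y := by
  rw [choose_eq_inv_smul_prod]
  refine (Commute.list_prod_left _ _ fun a ha => ?_).smul_left _
  obtain ⟨t, _, rfl⟩ := List.mem_map.1 ha
  exact h.sub_left (Nat.cast_commute t y)

theorem e_mem_kostant (i j : Fin N) : e v i j ∈ kostant v := by
  by_cases hij : i = j
  · subst hij
    have h : e v i i = hBinom v i 1 := by rw [hBinom_eq_choose, Ring.choose_one_right]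
    rw [h]
    exact (torusBinom v i 1).2
  · by_cases h : v i + v j = 0
    · have h1 : e v i j = divPow v i j 1 := by simp [divPow]
      rw [h1]
      exact (evenDivPow v i j hij h 1).2
    · exact (oddUnit v i j ((Fin.eq_one_of_ne_zero _ h))).2

/-- The matrix unit `e_{i,j}` as an element of the Kostant form. -/
def unitK (i j : Fin N) : kostant v := ⟨e v i j, e_mem_kostant v i j⟩

theorem unitK_mem (i j : Fin N) : unitK v i j ∈ kostantGrade v (v i + v j) := by
  rw [mem_kostantGrade]
  exact parityHom_e v i j

theorem isMatrixUnits_unitK : IsMatrixUnits v (unitK v) := by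
  intro i j a b
  apply Subtype.ext
  have h := e_bracket v i j a b
  simp only [AddSubgroupClass.coe_sub, AddSubgroupClass.coe_zsmul, Subring.coe_mul]
  refine h.trans ?_
  split_ifs <;> rfl

theorem matPow_mem (r : ℕ) (a b : Fin N) :
    matPow v (unitK v) r a b ∈ kostantGrade v (v a + v b) := by
  induction r generalizing a b with
  | zero =>
    simp only [matPow]
    split_ifs with h
    · subst h
      rw [CharTwo.add_self_eq_zero, ← zsmul_one]
      exact Submodule.smul_mem _ _ (one_mem_kostantGrade v)
    · exact Submodule.zero_mem _
  | succ r ih =>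
    simp only [matPow]
    refine Submodule.sum_mem _ fun c _ => Submodule.smul_mem _ _ ?_
    have h := kostantGrade_mul v (unitK_mem v a c) (ih c b)
    rwa [add_assoc, ← add_assoc (v c), CharTwo.add_self_eq_zero, zero_add] at h

theorem gelfand_mem (r : ℕ) : gelfand v (unitK v) r ∈ kostantGrade v 0 := by
  refine Submodule.sum_mem _ fun a _ => ?_
  have h := matPow_mem v r a a
  rwa [CharTwo.add_self_eq_zero] at h

variable (k : Type u) [Field k]

/-- The base change `U_ℤ → Dist(G)` as a ring homomorphism. -/
def toDistHom : kostant v →+* Dist v k :=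
  (Algebra.TensorProduct.includeRight : kostant v →ₐ[ℤ] Dist v k).toRingHom

theorem toDistHom_apply (x : kostant v) : toDistHom v k x = toDist v k x := rfl

variable {v}

/-- An element of the Kostant form that commutes with all matrix units is central in `Dist(G)`. -/
theorem commute_toDist {z : kostant v} (hz : ∀ i j, Commute (e v i j) (z : Env v))
    (a : Dist v k) : Commute (toDist v k z) a := by
  have h1 : ∀ y : kostant v, Commute z y := by
    rintro ⟨y, hy⟩
    suffices h : Commute (z : Env v) y from Subtype.ext h
    induction hy using Subring.closure_induction with
    | mem y hy =>
      rcases hy with (⟨i, j, _, rfl⟩ | ⟨i, j, r, _, _, rfl⟩) | ⟨i, r, rfl⟩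
      · exact (hz i j).symm
      · exact ((hz i j).symm.pow_right r).smul_right _
      · rw [hBinom_eq_choose]
        exact (commute_choose v (hz i i) r).symm
    | zero => exact Commute.zero_right _
    | one => exact Commute.one_right _
    | add x y _ _ hx hy => exact hx.add_right hy
    | neg x _ hx => exact hx.neg_right
    | mul x y _ _ hx hy => exact hx.mul_right hy
  induction a using TensorProduct.induction_on with
  | zero => exact Commute.zero_right _
  | add x y hx hy => exact hx.add_right hy
  | tmul c y =>
    change (1 ⊗ₜ[ℤ] z : Dist v k) * (c ⊗ₜ[ℤ] y) = (c ⊗ₜ[ℤ] y) * (1 ⊗ₜ[ℤ] z)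
    rw [Algebra.TensorProduct.tmul_mul_tmul, Algebra.TensorProduct.tmul_mul_tmul, one_mul, mul_one,
      (h1 y).eq]

theorem commute_gelfand_unitK (r : ℕ) (a : Dist v k) :
    Commute (toDist v k (gelfand v (unitK v) r)) a := by
  refine commute_toDist k (fun i j => ?_) a
  have h : ((gelfand v (unitK v) r : kostant v) : Env v) = gelfand v (e v) r :=
    map_gelfand (kostant v).subtype r
  rw [h]
  exact commute_gelfand (e_bracket v) r i j

theorem commute_sum_e (i j : Fin N) : Commute (e v i j) (∑ a, e v a a) := by
  rw [commute_iff_eq, ← sub_eq_zero, Finset.mul_sum, Finset.sum_mul, ← Finset.sum_sub_distrib]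
  have h : ∀ a, e v i j * e v a a - e v a a * e v i j =
      (if j = a then e v i a else 0) - (if i = a then e v a j else 0) := by
    intro a
    have := e_bracket v i j a a
    rwa [CharTwo.add_self_eq_zero, mul_zero, sgn_zero, one_smul, one_smul] at this
  rw [Finset.sum_congr rfl fun a _ => h a]
  simp

variable (v)

theorem commute_e_diag (i j : Fin N) : Commute (e v i i) (e v j j) := by
  have h := e_bracket v i i j j
  rw [CharTwo.add_self_eq_zero, zero_mul, sgn_zero, one_smul, one_smul] at h
  rw [commute_iff_eq, ← sub_eq_zero, h]
  split_ifs with hij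
  · subst hij; rw [sub_self]
  · rw [sub_self]

/-- The binomials in a partial sum of the `h_i` lie in the Kostant form and act on a highest weight
vector by the binomials of the partial degree: both sides expand by Vandermonde's identity. -/
theorem exists_kostant_choose_sum (lam : Weight N) (s : Finset (Fin N)) (r : ℕ) :
    ∃ t : kostant v, (t : Env v) = Ring.choose (∑ i ∈ s, e v i i) r ∧ t ∈ kostantGrade v 0 ∧
      toDist v k t - algebraMap k (Dist v k) ((Ring.choose (∑ i ∈ s, lam i) r : ℤ) : k)
        ∈ vermaIdeal v k lam := by
  induction s using Finset.induction_on generalizing r with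
  | empty =>
    rw [Finset.sum_empty, Finset.sum_empty]
    rcases r with _ | r
    · refine ⟨1, by simp, one_mem_kostantGrade v, ?_⟩
      have : toDist v k 1 = 1 := rfl
      rw [this, Ring.choose_zero_right, Int.cast_one, map_one, sub_self]
      exact Submodule.zero_mem _
    · refine ⟨0, by rw [Ring.choose_zero_succ]; rfl, Submodule.zero_mem _, ?_⟩
      have : toDist v k 0 = 0 := map_zero (toDistHom v k)
      rw [this, Ring.choose_zero_succ]
      simp
  | insert a s ha ih =>
    choose t ht1 ht2 ht3 using ih
    have hcomm : Commute (e v a a) (∑ i ∈ s, e v i i) :=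
      Commute.sum_right _ _ _ fun i _ => commute_e_diag v a i
    refine ⟨∑ ij ∈ Finset.HasAntidiagonal.antidiagonal r, torusBinom v a ij.1 * t ij.2, ?_, ?_, ?_⟩
    · rw [Finset.sum_insert ha, Ring.add_choose_eq r hcomm, AddSubmonoidClass.coe_finsetSum]
      refine Finset.sum_congr rfl fun ij _ => ?_
      rw [Subring.coe_mul, ht1, ← hBinom_eq_choose]
      rfl
    · refine Submodule.sum_mem _ fun ij _ => ?_
      have := kostantGrade_mul v (torusBinom_mem v a ij.1) (ht2 ij.2)
      rwa [zero_add] at this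
    · rw [Finset.sum_insert ha, Ring.add_choose_eq r (Commute.all _ _), Int.cast_sum, map_sum,
        ← toDistHom_apply, map_sum, ← Finset.sum_sub_distrib]
      refine Submodule.sum_mem _ fun ij _ => ?_
      have ha' : toDist v k (torusBinom v a ij.1)
          - algebraMap k (Dist v k) ((Ring.choose (lam a) ij.1 : ℤ) : k) ∈ vermaIdeal v k lam :=
        Submodule.subset_span (Or.inr ⟨a, ij.1, rfl⟩)
      rw [map_mul, toDistHom_apply, toDistHom_apply, Int.cast_mul, map_mul]
      set x := toDist v k (torusBinom v a ij.1)
      set y := toDist v k (t ij.2)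
      set c := ((Ring.choose (lam a) ij.1 : ℤ) : k)
      set d := ((Ring.choose (∑ i ∈ s, lam i) ij.2 : ℤ) : k)
      have h : x * y - algebraMap k (Dist v k) c * algebraMap k (Dist v k) d =
          x • (y - algebraMap k (Dist v k) d)
            + algebraMap k (Dist v k) d • (x - algebraMap k (Dist v k) c) := by
        rw [smul_eq_mul, smul_eq_mul, mul_sub, mul_sub, ← (Algebra.commutes d x),
          ← map_mul, ← map_mul, mul_comm c d]
        abel
      rw [h]
      exact Submodule.add_mem _ (Submodule.smul_mem _ _ (ht3 ij.2)) (Submodule.smul_mem _ _ ha')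

/-- The Gelfand invariants act on the generator of a Verma module by integers. -/
theorem gelfand_sub_mem (lam : Weight N) (r : ℕ) :
    toDist v k (gelfand v (unitK v) r) - algebraMap k (Dist v k)
      ((∑ a, sgn (v a) * diagEig v lam r a : ℤ) : k) ∈ vermaIdeal v k lam := by
  let E : Fin N → Fin N → Dist v k := fun i j => toDistHom v k (unitK v i j)
  have hE : IsMatrixUnits v E := by
    intro i j a b
    have h := congrArg (toDistHom v k) (isMatrixUnits_unitK v i j a b)
    simpa only [map_sub, map_mul, map_zsmul, apply_ite (toDistHom v k), map_zero] using h
  let x : Dist v k ⧸ vermaIdeal v k lam := (vermaIdeal v k lam).mkQ 1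
  have hsmul : ∀ a : Dist v k, a • x = (vermaIdeal v k lam).mkQ a := fun a => by
    rw [← map_smul, smul_eq_mul, mul_one]
  have hx : ∀ i j, i < j → E i j • x = 0 := by
    intro i j hij
    rw [hsmul, Submodule.mkQ_apply, Submodule.Quotient.mk_eq_zero]
    refine Submodule.subset_span (Or.inl ?_)
    by_cases h : v i + v j = 0
    · refine Or.inr ⟨i, j, hij, h, 1, le_rfl, ?_⟩
      refine congrArg (toDist v k) (Subtype.ext ?_)
      simp [unitK, evenDivPow, divPow]
    · exact Or.inl ⟨i, j, Fin.eq_one_of_ne_zero _ h, hij, rfl⟩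
  have hl : ∀ i, E i i • x = lam i • x := by
    intro i
    have h1 : E i i = toDist v k (torusBinom v i 1) := by
      refine congrArg (toDist v k) (Subtype.ext ?_)
      simp [unitK, torusBinom, hBinom_eq_choose]
    have h2 : toDist v k (torusBinom v i 1) - algebraMap k (Dist v k)
        ((Ring.choose (lam i) 1 : ℤ) : k) ∈ vermaIdeal v k lam :=
      Submodule.subset_span (Or.inr ⟨i, 1, rfl⟩)
    rw [← Int.cast_smul_eq_zsmul (Dist v k), hsmul, hsmul, ← sub_eq_zero, ← map_sub,
      Submodule.mkQ_apply, Submodule.Quotient.mk_eq_zero, h1]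
    simpa using h2
  have h := gelfand_smul hE hx hl r
  have hg : gelfand v E r = toDist v k (gelfand v (unitK v) r) :=
    (map_gelfand (toDistHom v k) r).symm
  rw [hg, ← Int.cast_smul_eq_zsmul (Dist v k), hsmul, hsmul, ← sub_eq_zero, ← map_sub,
      Submodule.mkQ_apply, Submodule.Quotient.mk_eq_zero] at h
  rwa [map_intCast]

variable {v k}

/-- A central element acts on a highest weight module by its scalar on the generator. -/
theorem simple_smul {lam : Weight N} {z : Dist v k} (hz : ∀ a, Commute z a) {c : k}
    (h : z - algebraMap k (Dist v k) c ∈ vermaIdeal v k lam) (x : (simple v k lam).carrier) :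
    z • x = c • x := by
  obtain ⟨y, rfl⟩ := (verma v k lam).rad.mkQ_surjective x
  obtain ⟨a, rfl⟩ := (vermaIdeal v k lam).mkQ_surjective y
  have h1 : (vermaIdeal v k lam).mkQ (z * a) = (vermaIdeal v k lam).mkQ (c • a) := by
    rw [← sub_eq_zero, ← map_sub, Submodule.mkQ_apply, Submodule.Quotient.mk_eq_zero]
    have h2 : z * a - c • a = a • (z - algebraMap k (Dist v k) c) := by
      rw [smul_eq_mul, mul_sub, ← (hz a).eq, ← Algebra.commutes]
      exact congrArg (z * a - ·) (Algebra.smul_def c a)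
    rw [h2]
    exact Submodule.smul_mem _ _ h
  exact congrArg (verma v k lam).rad.mkQ h1

/-- An even central element acting by different scalars on two highest weight vectors separates
the irreducible modules: `Ext¹` vanishes. -/
theorem ext1_simple_eq_zero {lam mu : Weight N} {z : kostant v} (h0 : z ∈ kostantGrade v 0)
    (hz : ∀ a, Commute (toDist v k z) a) {c d : k} (hcd : c ≠ d)
    (hc : toDist v k z - algebraMap k (Dist v k) c ∈ vermaIdeal v k lam)
    (hd : toDist v k z - algebraMap k (Dist v k) d ∈ vermaIdeal v k mu)
    (ξ : SuperMod.Ext1 (simple v k lam) (simple v k mu)) : ξ = 0 :=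
  Prod.ext
    (SuperMod.evenExt1_eq_zero (one_mem_distGrade v k) (toDist_mem v k h0) hz hcd
      (simple_smul hz hc) (simple_smul hz hd) ξ.1)
    (SuperMod.evenExt1_eq_zero (N := (simple v k mu).parityChange) (one_mem_distGrade v k)
      (toDist_mem v k h0) hz hcd (simple_smul hz hc) (fun x => simple_smul (lam := mu) hz hd x) ξ.2)

theorem wt_eq_of_ext1_ne_zero (p : ℕ) [CharP k p] {lam mu : Weight N}
    (ξ : SuperMod.Ext1 (simple v k lam) (simple v k mu)) (hξ : ξ ≠ 0) :
    wt v p lam = wt v p mu := by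
  refine wt_eq_of_eig_eq (K := k) v p (fun r => ?_) (int_eq_of_choose_eq (K := k) fun r => ?_)
  · by_contra hne
    exact hξ (ext1_simple_eq_zero (gelfand_mem v r) (commute_gelfand_unitK k r) hne
      (gelfand_sub_mem v k lam r) (gelfand_sub_mem v k mu r) ξ)
  · by_contra hne
    obtain ⟨t, ht1, ht2, ht3⟩ := exists_kostant_choose_sum v k lam Finset.univ r
    obtain ⟨t', ht1', -, ht3'⟩ := exists_kostant_choose_sum v k mu Finset.univ r
    obtain rfl : t = t' := Subtype.ext (ht1.trans ht1'.symm)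
    refine hξ (ext1_simple_eq_zero ht2 (commute_toDist k fun i j => ?_) hne ht3 ht3' ξ)
    rw [ht1]
    exact (commute_choose v (commute_sum_e i j).symm r).symm

end Central

end SuperGL

end

theorem theoremT (k : Type u) [Field k] (p : ℕ) [CharP k p] (m n : ℕ)
    (v : Fin (m + n) → ZMod 2)
    (hm : Fintype.card {i // v i = 0} = m) (hn : Fintype.card {i // v i = 1} = n)
    (lam mu : SuperGL.Weight (m + n)) :
    ((∃ ξ ∈ SuperGL.SuperMod.ext1In SuperGL.InO
        (SuperGL.simple v k lam) (SuperGL.simple v k mu), ξ ≠ 0) →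
      SuperGL.wt v p lam = SuperGL.wt v p mu) ∧
    ((∃ ξ : SuperGL.SuperMod.Ext1 (SuperGL.simple v k lam) (SuperGL.simple v k mu), ξ ≠ 0) →
      SuperGL.wt v p lam = SuperGL.wt v p mu) := by
  refine ⟨?_, ?_⟩
  · rintro ⟨ξ, -, hξ⟩
    exact SuperGL.wt_eq_of_ext1_ne_zero p ξ hξ
  · rintro ⟨ξ, hξ⟩
    exact SuperGL.wt_eq_of_ext1_ne_zero p ξ hξ
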